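/- Let $\mathcal H=\mathbb C\times\mathbb R$ be the Heisenberg group with $(z,u)\cdot(z',u')=(z+z',\,u+u'-\tfrac12\operatorname{Im}(z\bar z'))$, contact form $du+\tfrac12\operatorname{Im}(z\,d\bar z)$, and Korányi distance $d_{\mathcal H}(p,q)=\|p^{-1}q\|$, where $\|(z,u)\|=(|z|^4+16u^2)^{1/4}$. Horizontal vectors carry the inner product given by the Euclidean inner product of their $z$-components. Embed $\mathcal H\cup\{\infty\}$ in $\mathbb CP^2$ by $(z,u)\mapsto[1:z:-4u+i|z|^2]$, $\infty\mapsto[0:0:1]$; its image is the null cone of the Hermitian form $|v_1|^2-\operatorname{Im}(v_2\bar v_0)$ in homogeneous coordinates $[v_0:v_1:v_2]$, and $\mathrm{PU}(2,1)$, the group of projective transformations given by matrices preserving this form, acts on $\mathcal H\cup\{\infty\}$. An $\mathbb R$-circle is the image of $\{(x,0)\mid x\in\mathbb R\}\cup\{\infty\}$ under an element of $\mathrm{PU}(2,1)$. For distinct points $p,q$ and a horizontal direction at $p$ there is a unique $\mathbb R$-circle through $p$ and $q$ tangent to that direction at $p$. Let $K\subset\mathcal H$ be a finite Legendrian knot,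 i.e. a smooth closed horizontal curve without self-intersections, parametrized by arc length; $dp$ and $dq$ denote arc-length measure. For distinct $p,q\in K$ let $\Gamma_K(p,q)$ be the $\mathbb R$-circle through $p$ and $q$ tangent to $K$ at $p$, oriented by an orientation of $K$, and let $\theta_K(p,q)\in[0,\pi]$ be the angle at $p$ between the oriented $\mathbb R$-circles $\Gamma_K(p,q)$ and $\Gamma_K(q,p)$. Let $E(K)=B_K(-2)$, where $B_K$ is the meromorphic continuation of $\zeta\mapsto\iint_{K\times K}d_{\mathcal H}(p,q)^{\zeta}\,dp\,dq$ from $\operatorname{Re}\zeta>-1$ to a half-plane containing $-2$, namely $\operatorname{Re}\zeta>-3$. Then this continuation exists, it is analytic at $-2$, and $$E(K)=\iint_{K\times K}\frac{1-\cos\theta_K(p,q)}{d_{\mathcal H}(p,q)^2}\,dp\,dq,$$ the integral being absolutely convergent. Moreover, for every $p\in K$, $$V(K;p):=\lim_{\varepsilon\to+0}\left(\int_{\{q\in K\,:\,d_{\mathcal H}(p,q)\ge\varepsilon\}}\frac{dq}{d_{\mathcal H}(p,q)^2}-\frac2\varepsilon\right)=\int_K\frac{1-\cos\theta_K(p,q)}{d_{\mathcal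 H}(p,q)^2}\,dq,$$ where the limit exists and the last integral converges absolutely. -/

import Mathlib

open Set Filter Topology MeasureTheory
open scoped ContDiff

/-- The underlying space `ℂ × ℝ` of the Heisenberg group, with coordinates `(z, u)`. -/
abbrev Heis : Type := ℂ × ℝ

namespace Heis

/-- The group law `(z, u) · (z', u') = (z + z', u + u' - Im (z * conj z') / 2)`. -/
noncomputable def hmul (p q : Heis) : Heis :=
  (p.1 + q.1, p.2 + q.2 - (1 / 2) * (p.1 * (starRingEnd ℂ) q.1).im)

/-- The inverse for the Heisenberg group law. -/
noncomputable def hinv (p : Heis) : Heis := (-p.1, -p.2)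

/-- The Korányi norm `((x² + y²)² + 16 u²)^(1/4)`. -/
noncomputable def koranyiNorm (p : Heis) : ℝ :=
  ((p.1.re ^ 2 + p.1.im ^ 2) ^ 2 + 16 * p.2 ^ 2) ^ (1 / 4 : ℝ)

/-- The Korányi distance `‖p⁻¹ q‖`. -/
noncomputable def koranyiDist (p q : Heis) : ℝ := koranyiNorm (hmul (hinv p) q)

/-- The vector `v` (in the coordinates `(z, u)`) at `p` is horizontal: it is annihilated by the
contact form `du + (y dx - x dy) / 2 = du + Im (z d(conj z)) / 2`. -/
def IsHorizontal (p v : Heis) : Prop :=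
  v.2 + (1 / 2) * (p.1 * (starRingEnd ℂ) v.1).im = 0

/-- The homogeneous coordinates in `ℂP²` of a point of `Heis ∪ {∞}`, identified with the boundary of
the Siegel domain: `(z, u) ↦ [1 : z : -4 u + i |z|²]` and `∞ ↦ [0 : 0 : 1]`. -/
noncomputable def homCoord : OnePoint Heis → (Fin 3 → ℂ)
  | none => ![0, 0, 1]
  | some p => ![1, p.1, -4 * (p.2 : ℂ) + Complex.I * ((‖p.1‖ ^ 2 : ℝ) : ℂ)]

/-- The Hermitian form of signature `(2, 1)` whose null cone is the boundary of the Siegel domain. -/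
noncomputable def siegelForm : Matrix (Fin 3) (Fin 3) ℂ :=
  !![0, 0, -Complex.I / 2; 0, 1, 0; Complex.I / 2, 0, 0]

/-- `T` is a Möbius transformation of `Heis ∪ {∞}`, i.e. an element of `PU(2,1)`: it is the
projective action of a matrix that preserves the Hermitian form `siegelForm`. -/
def IsMoebius (T : OnePoint Heis → OnePoint Heis) : Prop :=
  ∃ A : Matrix (Fin 3) (Fin 3) ℂ,
    A.transpose * siegelForm * A.map (starRingEnd ℂ) = siegelForm ∧
    ∀ P, ∃ k : ℂ, k ≠ 0 ∧ A.mulVec (homCoord P) = k • homCoord (T P)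

/-- `c` is an oriented `ℝ`-circle with one point deleted: the image, under a Möbius
transformation `T`, of the standard infinite `ℝ`-circle `{(x, 0, 0) | x ∈ ℝ} ∪ {∞}`, oriented by
increasing `x`, the deleted point being `T ∞`. (The `ℝ`-circles, that is the boundaries of the
totally real totally geodesic planes of the complex hyperbolic plane, form a single orbit of
`PU(2,1)`. As the Möbius transformations that preserve the standard `ℝ`-circle act on it as
`PGL(2, ℝ)`, any point of an `ℝ`-circle can be the deleted one, and both orientations occur.) -/
def IsRCircle (c : ℝ → OnePoint Heis) : Prop :=
  ∃ T : OnePoint Heis → OnePoint Heis, IsMoebius T ∧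
    ∀ x : ℝ, c x = T ((((x : ℂ), (0 : ℝ)) : Heis) : OnePoint Heis)

/-- The curve `c` is at a finite point at the time `x`, with the velocity `v` there. -/
def HasVelocityAt (c : ℝ → OnePoint Heis) (v : Heis) (x : ℝ) : Prop :=
  ∃ c' : ℝ → Heis, (∀ᶠ y in 𝓝 x, c y = ((c' y : Heis) : OnePoint Heis)) ∧ HasDerivAt c' v x

/-- `c` is the oriented `ℝ`-circle through `p` and `q` that is tangent at `p` to the horizontal
vector `v`, with the orientation induced by `v`; it is at `p` at the time `a`, at `q` at the
time `b`. -/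
def IsTangentRCircle (p v q : Heis) (c : ℝ → OnePoint Heis) (a b : ℝ) : Prop :=
  IsRCircle c ∧ c a = (p : OnePoint Heis) ∧ c b = (q : OnePoint Heis) ∧
    ∃ r : ℝ, 0 < r ∧ HasVelocityAt c (r • v) a

/-- `θ` is the angle, measured at `p`, between the oriented `ℝ`-circle `c₁` through `p` and `q`
that is tangent to `v` at `p`, and the oriented `ℝ`-circle `c₂` through `q` and `p` that is tangent
to `w` at `q`. The inner product of horizontal vectors is the one for which
`X = ∂x - (y/2) ∂u` and `Y = ∂y + (x/2) ∂u` are orthonormal, i.e. the Euclidean inner product of the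
`z`-components. -/
def IsRCircleAngle (p v q w : Heis) (θ : ℝ) : Prop :=
  ∃ (c₁ c₂ : ℝ → OnePoint Heis) (a₁ b₁ a₂ b₂ : ℝ) (v₁ v₂ : Heis),
    IsTangentRCircle p v q c₁ a₁ b₁ ∧ IsTangentRCircle q w p c₂ a₂ b₂ ∧
    HasVelocityAt c₁ v₁ a₁ ∧ HasVelocityAt c₂ v₂ b₂ ∧
    θ = InnerProductGeometry.angle v₁.1 v₂.1

end Heis

/-- A finite Legendrian knot: a smooth closed Legendrian curve in the Heisenberg group without
self-intersections, parametrized by arc length and extended periodically to `ℝ`. -/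
structure LegendrianKnot where
  /-- the arc-length parametrization -/
  γ : ℝ → Heis
  /-- the length -/
  L : ℝ
  L_pos : 0 < L
  smooth : ContDiff ℝ ∞ γ
  periodic : Function.Periodic γ L
  injOn : Set.InjOn γ (Set.Ico 0 L)
  horizontal : ∀ s, Heis.IsHorizontal (γ s) (deriv γ s)
  unit_speed : ∀ s, ‖(deriv γ s).1‖ = 1

namespace LegendrianKnot

/-- The Korányi distance between the points of `K` with arc-length parameters `s` and `t`. -/
noncomputable def chord (K : LegendrianKnot) (s t : ℝ) : ℝ := Heis.koranyiDist (K.γ s) (K.γ t)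

/-- The angle `θ_K(p, q)` for `p = γ(s)` and `q = γ(t)` (of no significance if `p = q`). -/
noncomputable def angle (K : LegendrianKnot) (s t : ℝ) : ℝ :=
  Classical.epsilon (Heis.IsRCircleAngle (K.γ s) (deriv K.γ s) (K.γ t) (deriv K.γ t))

/-- The integrand `(1 - cos θ_K(p, q)) / d(p, q)²`, with the value `0` for `p = q`. -/
noncomputable def cosIntegrand (K : LegendrianKnot) (s t : ℝ) : ℝ :=
  (1 - Real.cos (K.angle s t)) / K.chord s t ^ 2

/-- `F` is the meromorphic continuation to the half-plane `Re ζ > -3` of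
`B_K(ζ) = ∬_{K × K} d(p, q)^ζ dp dq`, `Re ζ > -1`. The normal form fixes the values of `F`
at removable singularities, so that `F` is unique on this half-plane. -/
def IsBetaFunction (K : LegendrianKnot) (F : ℂ → ℂ) : Prop :=
  MeromorphicNFOn F {ζ : ℂ | -3 < ζ.re} ∧
    ∀ ζ : ℂ, -1 < ζ.re → F ζ = ∫ s in (0 : ℝ)..K.L, ∫ t in (0 : ℝ)..K.L, ((K.chord s t : ℝ) : ℂ) ^ ζ

/-- The (meromorphically continued) beta function of `K`. -/
noncomputable def betaFunction (K : LegendrianKnot) : ℂ → ℂ := Classical.epsilon K.IsBetaFunction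

/-- The energy `E(K) = B_K(-2)`. -/
noncomputable def energy (K : LegendrianKnot) : ℂ := K.betaFunction (-2)

/-- `V` is the potential of `K` at `p = γ(s)`: the limit for `ε → +0` of
`∫_{q ∈ K, d(p, q) ≥ ε} dq / d(p, q)² - 2 / ε`. -/
def IsPotential (K : LegendrianKnot) (s V : ℝ) : Prop :=
  Tendsto (fun ε : ℝ => (∫ t in Set.Ioc 0 K.L ∩ {t | ε ≤ K.chord s t}, 1 / K.chord s t ^ 2) - 2 / ε)
    (𝓝[>] 0) (𝓝 V)

end LegendrianKnot

/-! Let `φ(p, q)` be minus twice the Hermitian product of the standard lifts, so `|φ| = d²` for the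
Korányi distance `d`. The `ℝ`-circle tangent at `p` to `v` and passing through `q` lifts to a conic
on which the form is explicit. Invariance of the form then gives its direction at `q` as a positive
multiple of `v · conj φ / φ²` (`IsTangentRCircle.velocity`). Hence, for unit tangents `v` at `p` and
`w` at `q`, `cos θ / d² = Re (v · conj w · conj φ / φ²)` (`IsRCircleAngle.cos_eq`).

Along a knot with projection `z`, horizontality makes `∂φ/∂t = 2 conj z'(t) (z(t) - z(s))`, and the
expression above becomes `∂²(log d)/∂s∂t`, the real part of `mixed`. The integrand is therefore
`1/d² - ∂²(log d)/∂s∂t`. With `x = t - s` and `κ` the function `curv`, one has `φ = x² + iκx³/3 +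
O(x⁴)` uniformly in `s`. As the cubic term is imaginary, `d² = x² + O(x⁴)`, `log d = log |x| +
O(x²)`, and both `1/d²` and `Re mixed` equal `1/x² + O(1)`. So the integrand is bounded. Since `1/x²
- Re mixed` is the derivative of a function continuous across `0`, periodicity leaves only the
boundary terms of `-1/x`, and its integral over `|x| ≤ L/2` is `-4/L` (`integral_mixed_sub`). Thus
`∫ (1 - cos θ)/d² dt = ∫ (1/d² - 1/x²) dx - 4/L` (`integral_cosIntegrand`).

Both regularizations produce this right-hand side. For the potential, `{d ≥ ε}` differs from `{|x| ≥
ε}` only by a factor `exp(O(ε²))` in the radius, so `1/x²` contributes `2/ε - 4/L + o(1)`. For the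
beta function, `d^ζ - |x|^ζ = O(|x|^(Re ζ + 2))` has an integral holomorphic for `Re ζ > -3`, while
`|x|^ζ` contributes `2L (L/2)^(ζ+1)/(ζ+1)`, whose only pole is `-1` and whose value at `-2` is `-4 =
L · (-4/L)`. -/

/-! ### The Hermitian form, lifts of points and tangent vectors, and the standard conic -/

namespace Heis

/-- The Hermitian form of the matrix `siegelForm`. -/
noncomputable def herm (v w : Fin 3 → ℂ) : ℂ :=
  v 1 * (starRingEnd ℂ) (w 1) +
    Complex.I / 2 * (v 2 * (starRingEnd ℂ) (w 0) - v 0 * (starRingEnd ℂ) (w 2))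

theorem transpose_mul_siegelForm_mul_apply (A : Matrix (Fin 3) (Fin 3) ℂ) (i j : Fin 3) :
    (A.transpose * siegelForm * A.map (starRingEnd ℂ)) i j =
      herm (fun k => A k i) (fun k => A k j) := by
  simp [Matrix.mul_apply, Fin.sum_univ_three, siegelForm, herm]
  ring

theorem herm_mulVec {A : Matrix (Fin 3) (Fin 3) ℂ}
    (hA : A.transpose * siegelForm * A.map (starRingEnd ℂ) = siegelForm) (v w : Fin 3 → ℂ) :
    herm (A.mulVec v) (A.mulVec w) = herm v w := by
  have key : herm (A.mulVec v) (A.mulVec w) =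
      ∑ i, ∑ j, v i * (starRingEnd ℂ) (w j) * herm (fun k => A k i) (fun k => A k j) := by
    simp [Matrix.mulVec, dotProduct, Fin.sum_univ_three, herm]
    ring
  rw [key]
  simp_rw [← transpose_mul_siegelForm_mul_apply, hA]
  simp [Fin.sum_univ_three, siegelForm, herm]
  ring

/-- Homogeneous coordinates of a finite point. -/
noncomputable def lift (p : Heis) : Fin 3 → ℂ :=
  ![1, p.1, -4 * (p.2 : ℂ) + Complex.I * ((‖p.1‖ ^ 2 : ℝ) : ℂ)]

theorem homCoord_coe (p : Heis) : homCoord (p : OnePoint Heis) = lift p := rfl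

theorem homCoord_infty : homCoord (OnePoint.infty : OnePoint Heis) = ![0, 0, 1] := rfl

/-- The derivative of `lift` at `p` in the direction `v`. -/
noncomputable def tangentLift (p v : Heis) : Fin 3 → ℂ :=
  ![0, v.1, -4 * (v.2 : ℂ) + Complex.I * ((2 * (p.1 * (starRingEnd ℂ) v.1).re : ℝ) : ℂ)]

/-- Minus twice the Hermitian product of the lifts of two points; its modulus is the square of the
Korányi distance. -/
noncomputable def pairing (p q : Heis) : ℂ :=
  ((‖q.1 - p.1‖ ^ 2 : ℝ) : ℂ) -
    Complex.I * ((4 * (q.2 - p.2 + (1 / 2) * (p.1 * (starRingEnd ℂ) q.1).im) : ℝ) : ℂ)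

theorem sq_norm_eq (z : ℂ) : ‖z‖ ^ 2 = z.re ^ 2 + z.im ^ 2 := by
  rw [Complex.sq_norm, Complex.normSq_apply]; ring

theorem herm_lift (p q : Heis) : herm (lift p) (lift q) = -(1 / 2) * pairing p q := by
  apply Complex.ext <;> simp [herm, lift, pairing, sq_norm_eq, -Complex.ofReal_pow, -Complex.ofReal_add] <;> ring

/-- The contact condition eliminates the vertical component of `v`. This is the only way
horizontality enters the computations. -/
theorem herm_tangentLift {p v : Heis} (h : IsHorizontal p v) (q : Heis) :
    herm (tangentLift p v) (lift q) = v.1 * (starRingEnd ℂ) (q.1 - p.1) := by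
  unfold IsHorizontal at h
  have h' : v.2 = -((1 / 2) * (p.1 * (starRingEnd ℂ) v.1).im) := by linarith
  apply Complex.ext <;> simp [herm, lift, tangentLift, h'] <;> ring

theorem pairing_conj (p q : Heis) : (starRingEnd ℂ) (pairing p q) = pairing q p := by
  apply Complex.ext <;> simp [pairing, sq_norm_eq, -Complex.ofReal_pow, -Complex.ofReal_add] <;> ring

/-- The relation that simplifies both the velocity of an `ℝ`-circle and the second derivative of
`log φ`. -/
theorem pairing_add_conj (p q : Heis) :
    pairing p q + (starRingEnd ℂ) (pairing p q) =
      2 * ((q.1 - p.1) * (starRingEnd ℂ) (q.1 - p.1)) := by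
  apply Complex.ext <;> simp [pairing, sq_norm_eq, -Complex.ofReal_pow, -Complex.ofReal_add] <;> ring

theorem pairing_self (p : Heis) : pairing p p = 0 := by
  apply Complex.ext <;> simp [pairing]; ring

theorem pairing_ne_zero {p q : Heis} (h : p ≠ q) : pairing p q ≠ 0 := by
  intro h0
  apply h
  have h1 := congrArg Complex.re h0
  have h2 := congrArg Complex.im h0
  simp [pairing, -Complex.ofReal_pow] at h1
  have hz : q.1 = p.1 := by simpa [sub_eq_zero] using h1
  simp [pairing, hz, -Complex.ofReal_pow] at h2
  refine Prod.ext hz.symm ?_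
  nlinarith

theorem norm_pairing (p q : Heis) : ‖pairing p q‖ = koranyiDist p q ^ 2 := by
  have h : (((hmul (hinv p) q).1.re ^ 2 + (hmul (hinv p) q).1.im ^ 2) ^ 2 +
      16 * (hmul (hinv p) q).2 ^ 2) = ‖pairing p q‖ ^ 2 := by
    rw [sq_norm_eq (pairing p q)]
    simp [hmul, hinv, pairing, sq_norm_eq, -Complex.ofReal_pow, -Complex.ofReal_add]; ring
  rw [koranyiDist, koranyiNorm, h, ← Real.rpow_natCast _ 2, ← Real.rpow_natCast _ 2,
    ← Real.rpow_mul (by positivity), ← Real.rpow_mul (by positivity)]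
  norm_num

theorem koranyiDist_nonneg (p q : Heis) : 0 ≤ koranyiDist p q := by
  unfold koranyiDist koranyiNorm; positivity

/-- The conic `x ↦ [1 : x : i x²]` lifting the standard `ℝ`-circle. -/
noncomputable def conic (x : ℝ) : Fin 3 → ℂ := ![1, x, Complex.I * (x : ℂ) ^ 2]

/-- The derivative of `conic`. -/
noncomputable def conicDeriv (x : ℝ) : Fin 3 → ℂ := ![0, 1, Complex.I * (2 * (x : ℂ))]

theorem lift_ofReal (x : ℝ) : lift (((x : ℂ), (0 : ℝ)) : Heis) = conic x := by
  simp [lift, conic, ← Complex.ofReal_pow]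

theorem herm_conic (a b : ℝ) : herm (conic a) (conic b) = -(1 / 2) * ((a : ℂ) - b) ^ 2 := by
  simp [herm, conic]; ring_nf; simp; ring

theorem herm_conicDeriv_conic (a b : ℝ) : herm (conicDeriv a) (conic b) = b - a := by
  simp [herm, conic, conicDeriv]; ring_nf; simp; ring

theorem hasDerivAt_mulVec_conic (A : Matrix (Fin 3) (Fin 3) ℂ) (x : ℝ) (i : Fin 3) :
    HasDerivAt (fun y => A.mulVec (conic y) i) (A.mulVec (conicDeriv x) i) x := by
  have h1 : HasDerivAt (fun y : ℝ => (y : ℂ)) 1 x := Complex.ofRealCLM.hasDerivAt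
  have h : HasDerivAt (fun y : ℝ => A i 0 + A i 1 * y + A i 2 * (Complex.I * (y : ℂ) ^ 2))
      (A i 1 * 1 + A i 2 * (Complex.I * (2 * (x : ℂ) ^ 1 * 1))) x := by
    have := ((h1.const_mul (A i 1)).const_add (A i 0)).add
      (((h1.pow 2).const_mul Complex.I).const_mul (A i 2))
    simpa [Pi.add_def] using this
  have e1 : (fun y => A.mulVec (conic y) i) =
      fun y : ℝ => A i 0 + A i 1 * y + A i 2 * (Complex.I * (y : ℂ) ^ 2) := by
    funext y; simp [Matrix.mulVec, dotProduct, Fin.sum_univ_three, conic]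
  rw [e1]
  convert h using 1
  simp [Matrix.mulVec, dotProduct, Fin.sum_univ_three, conicDeriv]

theorem hasDerivAt_lift {c : ℝ → Heis} {v : Heis} {x : ℝ} (h : HasDerivAt c v x) (i : Fin 3) :
    HasDerivAt (fun y => lift (c y) i) (tangentLift (c x) v i) x := by
  have h1 : HasDerivAt (fun y => (c y).1) v.1 x := h.fst
  have h2 : HasDerivAt (fun y => (c y).2) v.2 x := h.snd
  fin_cases i
  · simpa [lift, tangentLift] using hasDerivAt_const x (1 : ℂ)
  · simpa [lift, tangentLift] using h1
  · have h3 := h1.norm_sq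
    have := (h2.ofReal_comp.const_mul (-4 : ℂ)).add (h3.ofReal_comp.const_mul Complex.I)
    refine this.congr_deriv ?_
    simp [tangentLift, Complex.inner]
    ring

end Heis

/-! ### Velocities along an `ℝ`-circle -/

namespace Heis

theorem HasVelocityAt.unique {c : ℝ → OnePoint Heis} {v w : Heis} {x : ℝ}
    (hv : HasVelocityAt c v x) (hw : HasVelocityAt c w x) : v = w := by
  obtain ⟨c₁, h₁, d₁⟩ := hv
  obtain ⟨c₂, h₂, d₂⟩ := hw
  have h : c₁ =ᶠ[𝓝 x] c₂ := by
    filter_upwards [h₁, h₂] with y e₁ e₂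
    exact OnePoint.coe_injective (e₁.symm.trans e₂)
  exact (d₁.congr_of_eventuallyEq h.symm).unique d₂

/-- Position and velocity of an `ℝ`-circle in terms of a lift to a conic. -/
theorem lift_of_hasVelocityAt {A : Matrix (Fin 3) (Fin 3) ℂ} {c : ℝ → OnePoint Heis}
    (hc : ∀ x, ∃ k : ℂ, k ≠ 0 ∧ A.mulVec (conic x) = k • homCoord (c x))
    {p v : Heis} {a : ℝ} (hp : c a = (p : OnePoint Heis)) (hv : HasVelocityAt c v a) :
    ∃ k m : ℂ, k ≠ 0 ∧ A.mulVec (conic a) = k • lift p ∧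
      A.mulVec (conicDeriv a) = m • lift p + k • tangentLift p v := by
  obtain ⟨c', h', d'⟩ := hv
  have hcp : c' a = p := OnePoint.coe_injective (h'.self_of_nhds.symm.trans hp)
  obtain ⟨k, hk, hX⟩ := hc a
  rw [hp, homCoord_coe] at hX
  refine ⟨k, A.mulVec (conicDeriv a) 0, hk, hX, ?_⟩
  funext i
  -- Standard lifts have zeroth coordinate `1`, so the scale factor is the zeroth coordinate of the
  -- conic. It is therefore differentiable, and the product rule applies.
  have e : (fun y => A.mulVec (conic y) i) =ᶠ[𝓝 a]
      fun y => A.mulVec (conic y) 0 * lift (c' y) i := by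
    filter_upwards [h'] with y hy
    obtain ⟨l, -, hl⟩ := hc y
    rw [hy, homCoord_coe] at hl
    rw [hl]
    simp [lift]
  have d1 := hasDerivAt_mulVec_conic A a i
  have d2 := ((hasDerivAt_mulVec_conic A a 0).mul (hasDerivAt_lift d' i)).congr_of_eventuallyEq e
  rw [d1.unique d2, hX, hcp]
  fin_cases i <;> simp [lift]

/-- The coordinates are quadratic polynomials, for which the trapezoidal rule applied to the
derivative is exact. -/
theorem mulVec_conicDeriv_sub (A : Matrix (Fin 3) (Fin 3) ℂ) {a b : ℝ} (i : Fin 3) :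
    ((a : ℂ) - b) * A.mulVec (conicDeriv b) i = -((a : ℂ) - b) * A.mulVec (conicDeriv a) i +
      2 * (A.mulVec (conic a) i - A.mulVec (conic b) i) := by
  simp [Matrix.mulVec, dotProduct, Fin.sum_univ_three, conicDeriv, conic]
  ring

theorem herm_smul_add (k l m n : ℂ) (u v w x : Fin 3 → ℂ) :
    herm (k • u + l • v) (m • w + n • x) =
      k * (starRingEnd ℂ) m * herm u w + k * (starRingEnd ℂ) n * herm u x +
      l * (starRingEnd ℂ) m * herm v w + l * (starRingEnd ℂ) n * herm v x := by
  simp [herm]; ring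

theorem herm_smul (k m : ℂ) (u w : Fin 3 → ℂ) :
    herm (k • u) (m • w) = k * (starRingEnd ℂ) m * herm u w := by
  simp [herm]; ring

/-- The direction at its second point of the `ℝ`-circle tangent to a given direction. -/
theorem IsTangentRCircle.velocity {p v q : Heis} {c : ℝ → OnePoint Heis} {a b : ℝ}
    (h : IsTangentRCircle p v q c a b) (hpv : IsHorizontal p v) (hpq : p ≠ q) {v₂ : Heis}
    (h₂ : HasVelocityAt c v₂ b) :
    ∃ r : ℝ, 0 < r ∧ v₂.1 = r * (v.1 * (starRingEnd ℂ) (pairing p q) / pairing p q ^ 2) := by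
  obtain ⟨⟨T, ⟨A, hA, hT⟩, hcT⟩, hca, hcb, r, hr, hvel⟩ := h
  have hφ := pairing_ne_zero hpq
  have hc : ∀ x, ∃ k : ℂ, k ≠ 0 ∧ A.mulVec (conic x) = k • homCoord (c x) := fun x => by
    rw [hcT x, ← lift_ofReal, ← homCoord_coe]; exact hT _
  obtain ⟨k₁, m₁, hk₁, hX₁, hD₁⟩ := lift_of_hasVelocityAt hc hca hvel
  obtain ⟨k₂, m₂, hk₂, hX₂, hD₂⟩ := lift_of_hasVelocityAt hc hcb h₂
  have hne : (a : ℂ) - b ≠ 0 := by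
    rw [sub_ne_zero]
    intro e
    have : a = b := by exact_mod_cast e
    subst this
    exact hpq (OnePoint.coe_injective (hca.symm.trans hcb))
  have t : tangentLift p (r • v) = (r : ℂ) • tangentLift p v := by
    funext i; fin_cases i <;> simp [tangentLift]; ring
  -- Invariance of the form, applied to the two points and then to the tangent at `a` and the point
  -- at `b`, determines `k₁ conj k₂` and `m₁ conj k₂`.
  have e1 : k₁ * (starRingEnd ℂ) k₂ * pairing p q = ((a : ℂ) - b) ^ 2 := by
    have := herm_mulVec hA (conic a) (conic b)
    rw [hX₁, hX₂, herm_smul, herm_lift, herm_conic] at this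
    linear_combination -2 * this
  have e2 : m₁ * (starRingEnd ℂ) k₂ * (-(1 / 2) * pairing p q) +
      k₁ * r * (starRingEnd ℂ) k₂ * (v.1 * (starRingEnd ℂ) (q.1 - p.1)) = b - a := by
    have := herm_mulVec hA (conicDeriv a) (conic b)
    rw [hD₁, hX₂, t, smul_smul, ← add_zero (k₂ • lift q), ← zero_smul ℂ (lift q),
      herm_smul_add, herm_lift, herm_tangentLift hpv, herm_conicDeriv_conic] at this
    simpa using this
  have e3 := mulVec_conicDeriv_sub A (a := a) (b := b) 0
  have e4 := mulVec_conicDeriv_sub A (a := a) (b := b) 1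
  rw [hX₁, hX₂, hD₁, hD₂, t] at e3 e4
  simp [lift, tangentLift] at e3 e4
  have hs := pairing_add_conj p q
  have hk₂n : k₂ * (starRingEnd ℂ) k₂ = ((‖k₂‖ ^ 2 : ℝ) : ℂ) := by
    rw [Complex.mul_conj, Complex.normSq_eq_norm_sq]
  have hk₂p : 0 < ‖k₂‖ ^ 2 := by positivity
  set φ := pairing p q
  refine ⟨r * (a - b) ^ 2 / ‖k₂‖ ^ 2, ?_, ?_⟩
  · have : a - b ≠ 0 := by exact_mod_cast hne
    positivity
  -- Coordinates `0` and `1` of the trapezoidal identity eliminate `m₂`. Multiplying by `conj k₂`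
  -- leaves only the products known from `e1` and `e2`, and the positive number `|k₂|²` in front of
  -- `v₂`.
  · have key : (k₂ * (starRingEnd ℂ) k₂) * φ ^ 2 * v₂.1 =
        r * ((a : ℂ) - b) ^ 2 * (v.1 * (starRingEnd ℂ) φ) := by
      have hm : ((a : ℂ) - b) * (k₂ * v₂.1) = ((a : ℂ) - b) * m₁ * (q.1 - p.1) -
          ((a : ℂ) - b) * (k₁ * (r * v.1)) - 2 * k₁ * (q.1 - p.1) := by
        linear_combination e4 - q.1 * e3
      refine mul_left_cancel₀ hne ?_
      have e2' : m₁ * (starRingEnd ℂ) k₂ * φ = 2 * ((a : ℂ) - b) +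
        2 * (k₁ * r * (starRingEnd ℂ) k₂ * (v.1 * (starRingEnd ℂ) (q.1 - p.1))) := by
          linear_combination -2 * e2
      linear_combination (starRingEnd ℂ) k₂ * φ ^ 2 * hm +
        ((a : ℂ) - b) * (q.1 - p.1) * φ * e2' +
        (-2 * φ * (q.1 - p.1) - r * v.1 * φ * (a - b) +
        2 * ((a : ℂ) - b) * (q.1 - p.1) * r * v.1 * (starRingEnd ℂ) (q.1 - p.1)) * e1
        - r * (a - b) ^ 3 * v.1 * hs
    rw [hk₂n] at key
    have hk₂d : (‖k₂‖ : ℂ) ≠ 0 := by exact_mod_cast (norm_pos_iff.mpr hk₂).ne'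
    push_cast at key ⊢
    field_simp
    linear_combination key

end Heis

/-! ### Existence of tangent `ℝ`-circles and the cosine of their angle -/

namespace Heis

/-- Every nonzero null vector is a multiple of the homogeneous coordinates of a point. -/
theorem exists_smul_homCoord {v : Fin 3 → ℂ} (hv : v ≠ 0) (h : herm v v = 0) :
    ∃ (k : ℂ) (P : OnePoint Heis), k ≠ 0 ∧ v = k • homCoord P := by
  by_cases h0 : v 0 = 0
  · have h1 : v 1 = 0 := by simpa [herm, h0] using h
    have h2 : v 2 ≠ 0 := fun h2 => hv (by funext i; fin_cases i <;> simp [h0, h1, h2])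
    refine ⟨v 2, OnePoint.infty, h2, ?_⟩
    rw [homCoord_infty]
    funext i; fin_cases i <;> simp [h0, h1]
  · have hn : v 1 / v 0 * (starRingEnd ℂ) (v 1 / v 0) +
        Complex.I / 2 * (v 2 / v 0 - (starRingEnd ℂ) (v 2 / v 0)) = 0 := by
      have h0' : (starRingEnd ℂ) (v 0) ≠ 0 := by simpa using h0
      unfold herm at h
      simp only [map_div₀]
      field_simp
      linear_combination 2 * h
    refine ⟨v 0, (((v 1 / v 0, -(v 2 / v 0).re / 4) : Heis) : OnePoint Heis), h0, ?_⟩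
    rw [homCoord_coe]
    have hre := congrArg Complex.re hn
    have e2 : v 2 / v 0 = -4 * ((-(v 2 / v 0).re / 4 : ℝ) : ℂ) +
        Complex.I * ((‖v 1 / v 0‖ ^ 2 : ℝ) : ℂ) := by
      rw [sq_norm_eq]
      set z := v 1 / v 0
      set w := v 2 / v 0
      simp at hre
      apply Complex.ext
      · simp [-Complex.ofReal_add]; ring
      · simp [-Complex.ofReal_add]; linarith
    funext i
    fin_cases i
    · simp [lift]
    · simp [lift]; field_simp
    · have : v 2 = v 0 * (v 2 / v 0) := by field_simp
      simp only [lift]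
      conv_lhs => rw [show v ((fun i => i) ⟨2, by norm_num⟩) = v 2 from rfl, this, e2]
      simp

/-- A vector in the kernel would be orthogonal to everything, and the form is nondegenerate. -/
theorem mulVec_ne_zero {A : Matrix (Fin 3) (Fin 3) ℂ}
    (hA : A.transpose * siegelForm * A.map (starRingEnd ℂ) = siegelForm) {v : Fin 3 → ℂ}
    (hv : v ≠ 0) : A.mulVec v ≠ 0 := by
  intro h
  apply hv
  have key : ∀ w, herm v w = 0 := fun w => by
    rw [← herm_mulVec hA, h]; simp [herm]
  have h0 := key ![0, 0, 1]
  have h1 := key ![0, 1, 0]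
  have h2 := key ![1, 0, 0]
  simp [herm] at h0 h1 h2
  funext i; fin_cases i <;> simp [h0, h1, h2]

theorem homCoord_ne_zero (P : OnePoint Heis) : homCoord P ≠ 0 := by
  induction P using OnePoint.rec with
  | infty => rw [homCoord_infty]; intro h; simpa using congrFun h 2
  | coe p => rw [homCoord_coe]; intro h; simpa [lift] using congrFun h 0

theorem herm_homCoord_self (P : OnePoint Heis) : herm (homCoord P) (homCoord P) = 0 := by
  induction P using OnePoint.rec with
  | infty => rw [homCoord_infty]; simp [herm]
  | coe p => rw [homCoord_coe, herm_lift, pairing_self, mul_zero]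

theorem exists_isMoebius {A : Matrix (Fin 3) (Fin 3) ℂ}
    (hA : A.transpose * siegelForm * A.map (starRingEnd ℂ) = siegelForm) :
    ∃ T : OnePoint Heis → OnePoint Heis,
      ∀ P, ∃ k : ℂ, k ≠ 0 ∧ A.mulVec (homCoord P) = k • homCoord (T P) := by
  have : ∀ P, ∃ (T : OnePoint Heis) (k : ℂ), k ≠ 0 ∧ A.mulVec (homCoord P) = k • homCoord T := by
    intro P
    obtain ⟨k, T, hk, h⟩ := exists_smul_homCoord (mulVec_ne_zero hA (homCoord_ne_zero P))
      (by rw [herm_mulVec hA, herm_homCoord_self])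
    exact ⟨T, k, hk, h⟩
  choose T hT using this
  exact ⟨T, hT⟩

theorem eq_coe_of_smul {P : OnePoint Heis} {q : Heis} {k l : ℂ} (hk : k ≠ 0) (hl : l ≠ 0)
    (h : k • homCoord P = l • lift q) : P = (q : OnePoint Heis) := by
  induction P using OnePoint.rec with
  | infty =>
    rw [homCoord_infty] at h
    have := congrFun h 0
    simp [lift, hl.symm] at this
  | coe p =>
    rw [homCoord_coe] at h
    have h0 : k = l := by simpa [lift] using congrFun h 0
    subst h0
    have h' : lift p = lift q := smul_right_injective _ hk h
    have h1 : p.1 = q.1 := by simpa [lift] using congrFun h' 1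
    have h2 := congrFun h' 2
    simp [lift, h1] at h2
    exact congrArg _ (Prod.ext h1 h2)

/-- An `ℝ`-circle has a velocity wherever it is finite. -/
theorem exists_hasVelocityAt {A : Matrix (Fin 3) (Fin 3) ℂ} {c : ℝ → OnePoint Heis}
    (hc : ∀ x, ∃ k : ℂ, k ≠ 0 ∧ A.mulVec (conic x) = k • homCoord (c x))
    {p : Heis} {a : ℝ} (hp : c a = (p : OnePoint Heis)) : ∃ v, HasVelocityAt c v a := by
  obtain ⟨k, hk, hX⟩ := hc a
  have h0 : A.mulVec (conic a) 0 ≠ 0 := by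
    rw [hX, hp, homCoord_coe]; simpa [lift] using hk
  have hd := fun i => hasDerivAt_mulVec_conic A a i
  have hq := fun i => (hd i).div (hd 0) h0
  have hre := (Complex.reCLM.hasFDerivAt.comp_hasDerivAt a (hq 2)).neg.div_const 4
  refine ⟨_, fun x => (A.mulVec (conic x) 1 / A.mulVec (conic x) 0,
    -(A.mulVec (conic x) 2 / A.mulVec (conic x) 0).re / 4), ?_, (hq 1).prodMk hre⟩
  filter_upwards [(hd 0).continuousAt.eventually_ne h0] with x hx
  obtain ⟨l, hl, hX'⟩ := hc x
  rcases hcx : c x with _ | q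
  · rw [hcx] at hX'
    rw [hX'] at hx
    exact absurd (by change l * ((![0, 0, 1] : Fin 3 → ℂ) 0) = 0; simp) hx
  · have e : A.mulVec (conic x) = l • lift q := by rw [hX', hcx]; rfl
    change (q : OnePoint Heis) = _
    rw [e]
    congr 1
    refine Prod.ext ?_ ?_
    · simp [lift, hl]
    · simp [lift, hl, -Complex.ofReal_pow]

theorem conj_two : (starRingEnd ℂ) 2 = 2 := Complex.conj_ofNat 2

theorem herm_conj (v w : Fin 3 → ℂ) : (starRingEnd ℂ) (herm v w) = herm w v := by
  simp [herm, conj_two]; ring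

/-- The tangent `ℝ`-circle through two points exists. -/
theorem exists_isTangentRCircle {p v q : Heis} (hpv : IsHorizontal p v) (hv : ‖v.1‖ = 1)
    (hpq : p ≠ q) : ∃ c a b, IsTangentRCircle p v q c a b ∧ (∃ v₂, HasVelocityAt c v₂ b) ∧
      HasVelocityAt c v a := by
  have hφ := pairing_ne_zero hpq
  have hφ' : (starRingEnd ℂ) (pairing p q) ≠ 0 := by simpa using hφ
  have hvv : v.1 * (starRingEnd ℂ) v.1 = 1 := by
    rw [Complex.mul_conj, Complex.normSq_eq_norm_sq, hv]; simp
  set φ := pairing p q with hφdef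
  set P := lift p with hP
  set Q := ((starRingEnd ℂ) φ)⁻¹ • lift q with hQ
  set E := tangentLift p v + (2 * (v.1 * (starRingEnd ℂ) (q.1 - p.1)) / φ) • lift p with hE
  have hPP : herm P P = 0 := by rw [hP, herm_lift, pairing_self, mul_zero]
  have hQQ : herm Q Q = 0 := by rw [hQ, herm_smul, herm_lift, pairing_self]; simp
  have hPQ : herm P Q = -(1 / 2) := by
    have := herm_smul 1 ((starRingEnd ℂ) φ)⁻¹ (lift p) (lift q)
    rw [one_smul, herm_lift] at this
    rw [hP, hQ, this, ← hφdef]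
    simp
    field_simp
  have hEP : herm E P = 0 := by
    have := herm_smul_add 1 (2 * (v.1 * (starRingEnd ℂ) (q.1 - p.1)) / φ) 1 0
      (tangentLift p v) (lift p) (lift p) 0
    rw [herm_tangentLift hpv, herm_lift, pairing_self] at this
    rw [hE]
    simpa using this
  have hEQ : herm E Q = 0 := by
    have := herm_smul_add 1 (2 * (v.1 * (starRingEnd ℂ) (q.1 - p.1)) / φ)
      ((starRingEnd ℂ) φ)⁻¹ 0 (tangentLift p v) (lift p) (lift q) 0
    rw [herm_tangentLift hpv, herm_lift, ← hφdef] at this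
    rw [one_smul, smul_zero, add_zero] at this
    rw [hE, hQ, this]
    simp
    field_simp
    ring
  have hEE : herm E E = 1 := by
    have := herm_smul_add 1 (2 * (v.1 * (starRingEnd ℂ) (q.1 - p.1)) / φ)
      1 (2 * (v.1 * (starRingEnd ℂ) (q.1 - p.1)) / φ)
      (tangentLift p v) (lift p) (tangentLift p v) (lift p)
    have h1 : herm (tangentLift p v) (tangentLift p v) = 1 := by
      rw [← hvv]; simp [herm, tangentLift]
    have h2 : herm (tangentLift p v) (lift p) = 0 := by
      rw [herm_tangentLift hpv]; simp
    have h3 : herm (lift p) (tangentLift p v) = 0 := by rw [← herm_conj, h2, map_zero]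
    rw [h1, h2, h3, herm_lift, pairing_self] at this
    rw [hE]
    simpa using this
  have hPE : herm P E = 0 := by rw [← herm_conj, hEP, map_zero]
  have hQE : herm Q E = 0 := by rw [← herm_conj, hEQ, map_zero]
  have hQP : herm Q P = -(1 / 2) := by rw [← herm_conj, hPQ]; simp [conj_two]
  clear_value P Q E
  -- The columns are chosen so that `A` maps `conic x` to `(1 - x)² P + x (1 - x) E + x² Q`, which
  -- runs from `P` at `0` to `Q` at `1` with initial derivative `E - 2P`. The factor `-i`
  -- compensates for the `i` in the last coordinate of `conic`.
  set A : Matrix (Fin 3) (Fin 3) ℂ := Matrix.of fun i j =>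
    ![P i, E i - 2 * P i, -Complex.I * (P i - E i + Q i)] j with hAdef
  have hA : A.transpose * siegelForm * A.map (starRingEnd ℂ) = siegelForm := by
    unfold herm at hPP hQQ hPQ hEP hEQ hEE hPE hQE hQP
    ext i j
    rw [transpose_mul_siegelForm_mul_apply]
    fin_cases i <;> fin_cases j <;> simp [herm, siegelForm, hAdef, conj_two]
    · linear_combination hPP
    · linear_combination hPE - 2 * hPP
    · linear_combination Complex.I * (hPP - hPE + hPQ)
    · linear_combination hEP - 2 * hPP
    · linear_combination hEE - 2 * hPE - 2 * hEP + 4 * hPP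
    · linear_combination Complex.I * (hEP - hEE + hEQ - 2 * (hPP - hPE + hPQ))
    · linear_combination -Complex.I * (hPP - hEP + hQP)
    · linear_combination -Complex.I * (hPE - hEE + hQE - 2 * (hPP - hEP + hQP))
    · linear_combination -Complex.I ^ 2 * (hPP - hEP + hQP - hPE + hEE - hQE + hPQ - hEQ + hQQ)
  obtain ⟨T, hT⟩ := exists_isMoebius hA
  have hX : ∀ x, A.mulVec (conic x) = (1 - (x : ℂ)) ^ 2 • P + ((x : ℂ) * (1 - x)) • E +
      ((x : ℂ) ^ 2) • Q := by
    intro x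
    funext i
    simp [Matrix.mulVec, dotProduct, Fin.sum_univ_three, conic, hAdef]
    ring_nf
    simp
    ring
  set c : ℝ → OnePoint Heis := fun x => T ((((x : ℂ), (0 : ℝ)) : Heis) : OnePoint Heis) with hcdef
  have hc : ∀ x, ∃ k : ℂ, k ≠ 0 ∧ A.mulVec (conic x) = k • homCoord (c x) := fun x => by
    rw [← lift_ofReal, ← homCoord_coe]; exact hT _
  have hc0 : c 0 = p := by
    obtain ⟨k, hk, h⟩ := hc 0
    exact eq_coe_of_smul hk one_ne_zero (by rw [← h, hX, ← hP]; simp)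
  have hc1 : c 1 = q := by
    obtain ⟨k, hk, h⟩ := hc 1
    exact eq_coe_of_smul hk (inv_ne_zero hφ') (by rw [← h, hX, ← hQ]; simp)
  obtain ⟨w, hw⟩ := exists_hasVelocityAt hc hc0
  have hwv : w = v := by
    obtain ⟨k, m, hk, h1, h2⟩ := lift_of_hasVelocityAt hc hc0 hw
    rw [hX, hP] at h1
    have hk1 : k = 1 := by simpa [lift] using (congrFun h1 0).symm
    subst hk1
    have h3 : A.mulVec (conicDeriv 0) = E - (2 : ℂ) • P := by
      funext i; simp [Matrix.mulVec, dotProduct, Fin.sum_univ_three, conicDeriv, hAdef]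
    rw [h3, hE, hP] at h2
    have e0 := congrFun h2 0
    have e1 := congrFun h2 1
    have e2 := congrFun h2 2
    simp [lift, tangentLift, -Complex.ofReal_pow] at e0 e1 e2
    rw [← e0] at e1 e2
    have z : w.1 = v.1 := by linear_combination -e1
    rw [z] at e2
    refine Prod.ext z ?_
    have : (v.2 : ℂ) = w.2 := by
      linear_combination -(1 / 4) * e2
    exact_mod_cast this.symm
  subst hwv
  exact ⟨c, 0, 1, ⟨⟨T, ⟨A, hA, hT⟩, fun _ => rfl⟩, hc0, hc1, 1, one_pos, by simpa using hw⟩,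
    exists_hasVelocityAt hc hc1, hw⟩

/-- Needed so that the `Classical.epsilon` in the definition of the angle picks a genuine angle. -/
theorem exists_isRCircleAngle {p v q w : Heis} (hp : IsHorizontal p v) (hq : IsHorizontal q w)
    (hv : ‖v.1‖ = 1) (hw : ‖w.1‖ = 1) (hpq : p ≠ q) : ∃ θ, IsRCircleAngle p v q w θ := by
  obtain ⟨c₁, a₁, b₁, h₁, -, hv₁⟩ := exists_isTangentRCircle hp hv hpq
  obtain ⟨c₂, a₂, b₂, h₂, ⟨v₂, hv₂⟩, -⟩ := exists_isTangentRCircle hq hw hpq.symm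
  exact ⟨_, c₁, c₂, a₁, b₁, a₂, b₂, v, v₂, h₁, h₂, hv₁, hv₂, rfl⟩

/-- The cosine of the angle between the two tangent `ℝ`-circles. -/
theorem IsRCircleAngle.cos_eq {p v q w : Heis} {θ : ℝ} (h : IsRCircleAngle p v q w θ)
    (hq : IsHorizontal q w) (hv : ‖v.1‖ = 1) (hw : ‖w.1‖ = 1) (hpq : p ≠ q) :
    Real.cos θ = ‖pairing p q‖ * (v.1 * (starRingEnd ℂ) w.1 *
      (starRingEnd ℂ) (pairing p q) / pairing p q ^ 2).re := by
  obtain ⟨c₁, c₂, a₁, b₁, a₂, b₂, v₁, v₂, h₁, h₂, hv₁, hv₂, rfl⟩ := h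
  -- The second circle starts at `q`, so its direction at `p` comes from the velocity formula with
  -- the roles exchanged; this conjugates the pairing.
  obtain ⟨r, hr, e⟩ := h₂.velocity hq hpq.symm hv₂
  obtain ⟨-, -, -, s, hs, hs'⟩ := h₁
  have e₁ : v₁.1 = s • v.1 := by rw [hv₁.unique hs']; rfl
  rw [← pairing_conj p q] at e
  have hφ := pairing_ne_zero hpq
  set φ := pairing p q
  have hφ' : (starRingEnd ℂ) φ ≠ 0 := by simpa using hφ
  set u := w.1 * (starRingEnd ℂ) ((starRingEnd ℂ) φ) / (starRingEnd ℂ) φ ^ 2 with hu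
  have hun : ‖u‖ = ‖φ‖⁻¹ := by
    simp [hu, hw]
    have : ‖φ‖ ≠ 0 := by simpa using hφ
    field_simp
  have e₂ : v₂.1 = r • u := by rw [e]; simp
  rw [e₁, e₂, InnerProductGeometry.angle_smul_left_of_pos _ _ hs,
    InnerProductGeometry.angle_smul_right_of_pos _ _ hr, InnerProductGeometry.cos_angle, hun, hv]
  rw [one_mul, div_inv_eq_mul, mul_comm]
  congr 1
  rw [real_inner_comm, Complex.inner, hu]
  congr 1
  simp
  ring

end Heis

/-! ### The knot, its projection and the pairing along it -/

namespace LegendrianKnot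

variable (K : LegendrianKnot)

/-- The projection of the knot to `ℂ`. -/
noncomputable def proj (s : ℝ) : ℂ := (K.γ s).1

/-- The pairing of the points of parameters `s` and `t`, of modulus `chord²`. -/
noncomputable def phi (s t : ℝ) : ℂ := Heis.pairing (K.γ s) (K.γ t)

theorem contDiff_proj : ContDiff ℝ ∞ K.proj := K.smooth.fst

theorem hasDerivAt_γ (s : ℝ) : HasDerivAt K.γ (deriv K.γ s) s :=
  (K.smooth.differentiable (by simp) s).hasDerivAt

theorem deriv_proj (s : ℝ) : deriv K.proj s = (deriv K.γ s).1 :=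
  HasDerivAt.deriv (f := K.proj) (K.hasDerivAt_γ s).fst

theorem norm_deriv_proj (s : ℝ) : ‖deriv K.proj s‖ = 1 := by
  rw [deriv_proj, K.unit_speed]

theorem deriv_proj_mul_conj (s : ℝ) : deriv K.proj s * (starRingEnd ℂ) (deriv K.proj s) = 1 := by
  rw [Complex.mul_conj, Complex.normSq_eq_norm_sq, norm_deriv_proj]; simp

theorem contDiff_deriv_proj : ContDiff ℝ ∞ (deriv K.proj) :=
  (contDiff_infty_iff_deriv.mp K.contDiff_proj).2

theorem contDiff_deriv_deriv_proj : ContDiff ℝ ∞ (deriv (deriv K.proj)) :=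
  (contDiff_infty_iff_deriv.mp K.contDiff_deriv_proj).2

theorem hasDerivAt_proj (s : ℝ) : HasDerivAt K.proj (deriv K.proj s) s :=
  (K.contDiff_proj.differentiable (by simp) s).hasDerivAt

theorem hasDerivAt_deriv_proj (s : ℝ) :
    HasDerivAt (deriv K.proj) (deriv (deriv K.proj) s) s :=
  (K.contDiff_deriv_proj.differentiable (by simp) s).hasDerivAt

theorem hasDerivAt_deriv_deriv_proj (s : ℝ) :
    HasDerivAt (deriv (deriv K.proj)) (deriv (deriv (deriv K.proj)) s) s :=
  (K.contDiff_deriv_deriv_proj.differentiable (by simp) s).hasDerivAt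

theorem periodic_proj : Function.Periodic K.proj K.L := fun s => by
  simp [proj, K.periodic s]

theorem _root_.Function.Periodic.deriv' {E : Type*} [NormedAddCommGroup E] [NormedSpace ℝ E]
    {f : ℝ → E} {T : ℝ} (h : Function.Periodic f T) : Function.Periodic (deriv f) T := fun s => by
  rw [← deriv_comp_add_const]; congr 1; funext x; exact h x

theorem exists_bound_of_periodic {f : ℝ → ℂ} (hf : Continuous f) (hp : Function.Periodic f K.L) :
    ∃ M, ∀ s, ‖f s‖ ≤ M := by
  obtain ⟨M, hM⟩ := (hp.isBounded_of_continuous K.L_pos.ne' hf).exists_norm_le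
  exact ⟨M, fun s => hM _ ⟨s, rfl⟩⟩

/-- The form is conjugate-linear in its second argument, so the derivative is the product with
`tangentLift`, which horizontality makes explicit. -/
theorem hasDerivAt_phi (s t : ℝ) :
    HasDerivAt (K.phi s)
      (2 * ((starRingEnd ℂ) (deriv K.proj t) * (K.proj t - K.proj s))) t := by
  have e : K.phi s = fun t => -2 * Heis.herm (Heis.lift (K.γ s)) (Heis.lift (K.γ t)) := by
    funext t; rw [Heis.herm_lift, phi]; ring
  have hd := fun i => Heis.hasDerivAt_lift (K.hasDerivAt_γ t) i
  have hc := fun i => (hd i).star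
  have h := (((hc 1).const_mul (Heis.lift (K.γ s) 1)).add
    ((((hc 0).const_mul (Heis.lift (K.γ s) 2)).sub
      ((hc 2).const_mul (Heis.lift (K.γ s) 0))).const_mul (Complex.I / 2))).const_mul (-2)
  rw [e]
  refine HasDerivAt.congr_deriv (f' := -2 * Heis.herm (Heis.lift (K.γ s))
    (Heis.tangentLift (K.γ t) (deriv K.γ t))) h ?_
  rw [← Heis.herm_conj, Heis.herm_tangentLift (K.horizontal t), deriv_proj]
  simp [proj]
  ring

theorem phi_self (s : ℝ) : K.phi s s = 0 := Heis.pairing_self _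

theorem norm_phi (s t : ℝ) : ‖K.phi s t‖ = K.chord s t ^ 2 := Heis.norm_pairing _ _

theorem chord_nonneg (s t : ℝ) : 0 ≤ K.chord s t := Heis.koranyiDist_nonneg _ _

theorem continuous_phi : Continuous fun x : ℝ × ℝ => K.phi x.1 x.2 := by
  have := K.smooth.continuous
  unfold phi Heis.pairing
  fun_prop

theorem phi_add_L_right (s t : ℝ) : K.phi s (t + K.L) = K.phi s t := by
  simp [phi, K.periodic t]

theorem phi_add_L_left (s t : ℝ) : K.phi (s + K.L) t = K.phi s t := by
  simp [phi, K.periodic s]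

/-- Injectivity on one period forces `x` to be a multiple of `L`, and the only one in this range is
`0`. -/
theorem γ_ne {s x : ℝ} (h0 : x ≠ 0) (hx : |x| ≤ K.L / 2) : K.γ s ≠ K.γ (s + x) := by
  intro h
  have hL := K.L_pos
  have e : ∀ t, K.γ (toIcoMod hL 0 t) = K.γ t := fun t => by
    rw [← self_sub_toIcoDiv_zsmul, K.periodic.sub_zsmul_eq]
  have h' := K.injOn (toIcoMod_mem_Ico' hL s) (toIcoMod_mem_Ico' hL (s + x))
    (by rw [e, e, h])
  obtain ⟨n, hn⟩ := (toIcoMod_eq_toIcoMod hL).mp h'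
  rw [add_sub_cancel_left, zsmul_eq_mul] at hn
  have hn0 : n ≠ 0 := by rintro rfl; simp at hn; exact h0 hn
  have h1 : (1 : ℝ) ≤ |(n : ℝ)| := by exact_mod_cast Int.one_le_abs hn0
  rw [hn, abs_mul, abs_of_pos hL] at hx
  nlinarith

theorem phi_ne_zero {s x : ℝ} (h0 : x ≠ 0) (hx : |x| ≤ K.L / 2) : K.phi s (s + x) ≠ 0 :=
  Heis.pairing_ne_zero (K.γ_ne h0 hx)

end LegendrianKnot

/-! ### Taylor expansions near the diagonal, uniform in the base point -/

namespace LegendrianKnot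

open Asymptotics

/-- The pairs `(s, x)` with `|x| ≤ R`. -/
def band (R : ℝ) : Set (ℝ × ℝ) := {p | |p.2| ≤ R}

/-- Mean value inequality in the second variable. Big-O along the principal filter of the band is
one bound valid at all its points, so remainders can be integrated repeatedly with constants
independent of `s`. -/
theorem isBigO_band_of_hasDerivAt {R : ℝ} {n : ℕ} {f f' : ℝ × ℝ → ℂ}
    (hd : ∀ s x, HasDerivAt (fun y => f (s, y)) (f' (s, x)) x) (h0 : ∀ s, f (s, 0) = 0)
    (h : f' =O[𝓟 (band R)] fun p => p.2 ^ n) : f =O[𝓟 (band R)] fun p => p.2 ^ (n + 1) := by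
  rw [isBigO_principal] at h ⊢
  obtain ⟨c, hc⟩ := h
  refine ⟨|c|, fun p hp => ?_⟩
  have hb : ∀ y ∈ Metric.closedBall (0 : ℝ) |p.2|, ‖f' (p.1, y)‖ ≤ |c| * |p.2| ^ n := by
    intro y hy
    have hy' : |y| ≤ |p.2| := by simpa using hy
    refine (hc (p.1, y) (show |y| ≤ R from hy'.trans hp)).trans ?_
    rw [norm_pow, Real.norm_eq_abs]
    have := pow_le_pow_left₀ (abs_nonneg y) hy' n
    have h1 := le_abs_self c
    have h2 : 0 ≤ |y| ^ n := by positivity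
    have h3 := abs_nonneg c
    nlinarith
  have := (convex_closedBall (0 : ℝ) |p.2|).norm_image_sub_le_of_norm_hasDerivWithin_le
    (f := fun y => f (p.1, y)) (fun y _ => (hd p.1 y).hasDerivWithinAt) hb
    (x := 0) (y := p.2) (by simp) (by simp)
  rw [h0, sub_zero, sub_zero] at this
  refine this.trans (le_of_eq ?_)
  rw [norm_pow, Real.norm_eq_abs]; ring

theorem isBigO_band_one {R : ℝ} {f : ℝ × ℝ → ℂ} {M : ℝ} (h : ∀ p ∈ band R, ‖f p‖ ≤ M) :
    f =O[𝓟 (band R)] fun _ => (1 : ℝ) :=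
  isBigO_principal.mpr ⟨M, fun p hp => by simpa using h p hp⟩

theorem isBigO_band_ofReal_pow {R : ℝ} (n : ℕ) :
    (fun p : ℝ × ℝ => (p.2 : ℂ) ^ n) =O[𝓟 (band R)] fun p => p.2 ^ n :=
  isBigO_principal.mpr ⟨1, fun p _ => by simp⟩

theorem _root_.Asymptotics.IsBigO.conj {α : Type*} {l : Filter α} {f : α → ℂ} {g : α → ℝ}
    (h : f =O[l] g) : (fun x => (starRingEnd ℂ) (f x)) =O[l] g := by
  refine (IsBigO.of_norm_left ?_)
  simpa using h.norm_left

theorem isBigO_band_pow_pow {R : ℝ} {m n : ℕ} (h : m ≤ n) :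
    (fun p : ℝ × ℝ => p.2 ^ n) =O[𝓟 (band R)] fun p => p.2 ^ m := by
  refine isBigO_principal.mpr ⟨|R| ^ (n - m), fun p hp => ?_⟩
  have hp' : |p.2| ≤ |R| := le_trans hp (le_abs_self R)
  rw [norm_pow, norm_pow, Real.norm_eq_abs, ← Nat.sub_add_cancel h, pow_add, Nat.sub_add_cancel h]
  gcongr

variable (K : LegendrianKnot)

/-- The signed curvature of the projection, up to sign. -/
noncomputable def curv (s : ℝ) : ℝ :=
  (deriv K.proj s * (starRingEnd ℂ) (deriv (deriv K.proj) s)).im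

theorem deriv_proj_mul_conj_deriv_deriv (s : ℝ) :
    deriv K.proj s * (starRingEnd ℂ) (deriv (deriv K.proj) s) = Complex.I * K.curv s := by
  -- Differentiating `|z'|² = 1` shows that `z' conj z''` is purely imaginary.
  have h := (K.hasDerivAt_deriv_proj s).norm_sq
  have h1 : (fun s => ‖deriv K.proj s‖ ^ 2) = fun _ => (1 : ℝ) := by
    funext t; rw [norm_deriv_proj]; norm_num
  rw [h1] at h
  have h2 := h.unique (hasDerivAt_const s (1 : ℝ))
  have h3 : (deriv K.proj s * (starRingEnd ℂ) (deriv (deriv K.proj) s)).re = 0 := by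
    rw [Complex.inner] at h2
    simp at h2 ⊢
    linarith
  apply Complex.ext
  · rw [h3]; simp
  · simp [curv]

theorem conj_deriv_proj_mul_deriv_deriv (s : ℝ) :
    (starRingEnd ℂ) (deriv K.proj s) * deriv (deriv K.proj) s = -(Complex.I * K.curv s) := by
  have := congrArg (starRingEnd ℂ) (K.deriv_proj_mul_conj_deriv_deriv s)
  simpa using this

local notation "S" => 𝓟 (band (K.L / 2))

theorem isBigO_comp_fst {f : ℝ → ℂ} (hf : Continuous f) (hp : Function.Periodic f K.L) :
    (fun p : ℝ × ℝ => f p.1) =O[S] fun _ => (1 : ℝ) := by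
  obtain ⟨M, hM⟩ := K.exists_bound_of_periodic hf hp
  exact isBigO_band_one (M := M) fun p _ => hM p.1

theorem isBigO_proj_dd : (fun p : ℝ × ℝ => deriv (deriv K.proj) p.1) =O[S] fun _ => (1 : ℝ) :=
  K.isBigO_comp_fst K.contDiff_deriv_deriv_proj.continuous K.periodic_proj.deriv'.deriv'

theorem isBigO_proj_d : (fun p : ℝ × ℝ => deriv K.proj p.1) =O[S] fun _ => (1 : ℝ) :=
  K.isBigO_comp_fst K.contDiff_deriv_proj.continuous K.periodic_proj.deriv'

theorem isBigO_curv : (fun p : ℝ × ℝ => Complex.I * (K.curv p.1 : ℂ)) =O[S] fun _ => (1 : ℝ) := by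
  simpa [deriv_proj_mul_conj_deriv_deriv] using K.isBigO_proj_d.mul K.isBigO_proj_dd.conj

/-- Remainder of the first-order expansion of the unit tangent. -/
theorem isBigO_deriv_proj_sub :
    (fun p : ℝ × ℝ => deriv K.proj (p.1 + p.2) - deriv K.proj p.1 - p.2 * deriv (deriv K.proj) p.1)
      =O[S] fun p => p.2 ^ 2 := by
  obtain ⟨M, hM⟩ := K.exists_bound_of_periodic
    (contDiff_infty_iff_deriv.mp K.contDiff_deriv_deriv_proj).2.continuous
    K.periodic_proj.deriv'.deriv'.deriv'
  have h0 : (fun p : ℝ × ℝ => deriv (deriv (deriv K.proj)) (p.1 + p.2)) =O[S] fun p => p.2 ^ 0 := by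
    simpa using isBigO_band_one (M := M) fun p _ => hM _
  have h1 : (fun p : ℝ × ℝ => deriv (deriv K.proj) (p.1 + p.2) - deriv (deriv K.proj) p.1)
      =O[S] fun p => p.2 ^ (0 + 1) := by
    refine isBigO_band_of_hasDerivAt (fun s x => ?_) (fun s => by simp) h0
    exact ((K.hasDerivAt_deriv_deriv_proj (s + x)).comp_const_add s x).sub_const
      (deriv (deriv K.proj) s)
  refine isBigO_band_of_hasDerivAt (fun s x => ?_) (fun s => by simp) h1
  have hx : HasDerivAt (fun y : ℝ => (y : ℂ)) 1 x := Complex.ofRealCLM.hasDerivAt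
  simpa using (((K.hasDerivAt_deriv_proj (s + x)).comp_const_add s x).sub_const _).fun_sub
    (hx.mul_const (deriv (deriv K.proj) s))

/-- Remainder of the second-order expansion of the projection. -/
theorem isBigO_proj_sub :
    (fun p : ℝ × ℝ => K.proj (p.1 + p.2) - K.proj p.1 - p.2 * deriv K.proj p.1 -
      p.2 ^ 2 / 2 * deriv (deriv K.proj) p.1) =O[S] fun p => p.2 ^ 3 := by
  refine isBigO_band_of_hasDerivAt (fun s x => ?_) (fun s => by simp) K.isBigO_deriv_proj_sub
  have hx : HasDerivAt (fun y : ℝ => (y : ℂ)) 1 x := Complex.ofRealCLM.hasDerivAt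
  have h := ((((K.hasDerivAt_proj (s + x)).comp_const_add s x).sub_const (K.proj s)).fun_sub
    (hx.mul_const (deriv K.proj s))).fun_sub
      (((hx.fun_pow 2).div_const 2).mul_const (deriv (deriv K.proj) s))
  refine h.congr_deriv ?_
  simp

theorem isBigO_proj_sub_one :
    (fun p : ℝ × ℝ => K.proj (p.1 + p.2) - K.proj p.1) =O[S] fun p => p.2 ^ 1 := by
  refine isBigO_band_of_hasDerivAt (n := 0) (f' := fun p => deriv K.proj (p.1 + p.2))
    (fun s x => ?_) (fun s => by simp) ?_
  · exact ((K.hasDerivAt_proj (s + x)).comp_const_add s x).sub_const (K.proj s)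
  · simpa using isBigO_band_one (M := 1) fun p _ => (K.norm_deriv_proj _).le

/-- In the product of the expansions of `conj z'(s + x)` and `z(s + x) - z(s)`, the `x²` terms are
`iκ` and `-iκ/2`; doubling their sum gives `iκ`. -/
theorem isBigO_deriv_phi :
    (fun p : ℝ × ℝ => 2 * ((starRingEnd ℂ) (deriv K.proj (p.1 + p.2)) *
      (K.proj (p.1 + p.2) - K.proj p.1)) - 2 * p.2 - Complex.I * K.curv p.1 * p.2 ^ 2)
      =O[S] fun p => p.2 ^ 3 := by
  have r₁ := K.isBigO_deriv_proj_sub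
  have r₂ := K.isBigO_proj_sub
  have r₃ := K.isBigO_proj_sub_one
  have x1 := isBigO_band_ofReal_pow (R := K.L / 2) 1
  have x3 := isBigO_band_ofReal_pow (R := K.L / 2) 3
  have t1 := (K.isBigO_proj_dd.conj.mul K.isBigO_proj_dd).mul x3
  have t2 := (K.isBigO_proj_d.conj.mul r₂)
  have t3 := (((K.isBigO_proj_dd.conj.mul x1).mul r₂).congr_right (g₂ := fun p => p.2 ^ 4)
    (fun p => by ring)).trans (isBigO_band_pow_pow (R := K.L / 2) (m := 3) (by norm_num))
  have t4 := r₁.conj.mul r₃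
  have h := ((t1.congr_right (g₂ := fun p => p.2 ^ 3) (fun p => by simp)).add
    ((t2.congr_right (g₂ := fun p => p.2 ^ 3) (fun p => by simp)).const_mul_left 2)).add
    ((t3.const_mul_left 2).add
      ((t4.congr_right (g₂ := fun p => p.2 ^ 3) (fun p => by ring)).const_mul_left 2))
  refine h.congr_left fun p => ?_
  have e1 := K.deriv_proj_mul_conj p.1
  have e2 := K.deriv_proj_mul_conj_deriv_deriv p.1
  have e3 := K.conj_deriv_proj_mul_deriv_deriv p.1
  simp only [map_sub, map_mul, Complex.conj_ofReal]
  linear_combination -2 * (p.2 : ℂ) * e1 - 2 * (p.2 : ℂ) ^ 2 * e2 - (p.2 : ℂ) ^ 2 * e3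

theorem isBigO_phi_sub :
    (fun p : ℝ × ℝ => K.phi p.1 (p.1 + p.2) - p.2 ^ 2 - Complex.I * K.curv p.1 * p.2 ^ 3 / 3)
      =O[S] fun p => p.2 ^ 4 := by
  refine isBigO_band_of_hasDerivAt (fun s x => ?_) (fun s => by simp [phi_self]) K.isBigO_deriv_phi
  have hx : HasDerivAt (fun y : ℝ => (y : ℂ)) 1 x := Complex.ofRealCLM.hasDerivAt
  have h := (((K.hasDerivAt_phi s (s + x)).comp_const_add s x).fun_sub (hx.fun_pow 2)).fun_sub
    (((hx.fun_pow 3).const_mul (Complex.I * K.curv s)).div_const 3)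
  refine h.congr_deriv ?_
  simp
  ring

end LegendrianKnot

/-! ### Uniform estimates for the chord and the derivatives of its logarithm -/

namespace LegendrianKnot

open Asymptotics

variable (K : LegendrianKnot)

local notation "S" => 𝓟 (band (K.L / 2))

theorem isBigO_phi : (fun p : ℝ × ℝ => K.phi p.1 (p.1 + p.2)) =O[S] fun p => p.2 ^ 2 := by
  have x2 := isBigO_band_ofReal_pow (R := K.L / 2) 2
  have x3 := (isBigO_band_ofReal_pow (R := K.L / 2) 3).trans
    (isBigO_band_pow_pow (m := 2) (by norm_num))
  have h := ((K.isBigO_phi_sub.trans (isBigO_band_pow_pow (m := 2) (by norm_num))).add x2).add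
    (((K.isBigO_curv.mul x3).congr_right (g₂ := fun p => p.2 ^ 2) (fun p => by ring)).const_mul_left
      (1 / 3))
  exact h.congr_left fun p => by ring

/-- Near the diagonal the quadratic term dominates. Away from it, `φ` has no zeros because the knot
has no self-intersections, and compactness gives a positive minimum. -/
theorem exists_phi_lower_bound :
    ∃ c : ℝ, 0 < c ∧ ∀ s x : ℝ, |x| ≤ K.L / 2 → c * x ^ 2 ≤ ‖K.phi s (s + x)‖ := by
  have hL := K.L_pos
  have x3 := isBigO_band_ofReal_pow (R := K.L / 2) 3
  have h : (fun p : ℝ × ℝ => K.phi p.1 (p.1 + p.2) - p.2 ^ 2) =O[S] fun p => p.2 ^ 3 := by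
    have h := (K.isBigO_phi_sub.trans (isBigO_band_pow_pow (m := 3) (by norm_num))).add
      (((K.isBigO_curv.mul x3).congr_right (g₂ := fun p => p.2 ^ 3) (fun p => by ring)).const_mul_left
      (1 / 3))
    exact h.congr_left fun p => by ring
  obtain ⟨C, hC⟩ := isBigO_principal.mp h
  -- Chosen so that the cubic remainder is at most half of `x²` when `|x| ≤ δ`.
  set δ : ℝ := 1 / (2 * (|C| + 1)) with hδ
  have hδ0 : 0 < δ := by positivity
  have hnear : ∀ s x : ℝ, |x| ≤ K.L / 2 → |x| ≤ δ → 1 / 2 * x ^ 2 ≤ ‖K.phi s (s + x)‖ := by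
    intro s x hx hx'
    have h1 := hC (s, x) hx
    simp only [norm_pow, Real.norm_eq_abs] at h1
    have h2 : C * |x| ^ 3 ≤ 1 / 2 * x ^ 2 := by
      have h3 : C * |x| ≤ 1 / 2 := by
        calc C * |x| ≤ (|C| + 1) * δ := by
              have := le_abs_self C
              have := abs_nonneg x
              have := abs_nonneg C
              nlinarith
          _ = 1 / 2 := by rw [hδ]; field_simp
      calc C * |x| ^ 3 = C * |x| * x ^ 2 := by rw [← sq_abs x]; ring
        _ ≤ _ := by gcongr
    have h4 : ‖((x : ℂ)) ^ 2‖ = x ^ 2 := by simp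
    have h5 := norm_sub_norm_le ((x : ℂ) ^ 2) (K.phi s (s + x))
    rw [norm_sub_rev, h4] at h5
    linarith
  set Q : Set (ℝ × ℝ) := Icc 0 K.L ×ˢ (Icc (-(K.L / 2)) (K.L / 2) ∩ {x | δ ≤ |x|}) with hQ
  have hQc : IsCompact Q := isCompact_Icc.prod (isCompact_Icc.inter_right
    (isClosed_le continuous_const continuous_abs))
  have hcont : Continuous fun p : ℝ × ℝ => ‖K.phi p.1 (p.1 + p.2)‖ :=
    (K.continuous_phi.comp (f := fun p : ℝ × ℝ => (p.1, p.1 + p.2)) (by fun_prop)).norm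
  have hper : ∀ x, Function.Periodic (fun s => K.phi s (s + x)) K.L := fun x s => by
    simp only
    rw [phi_add_L_left, add_right_comm, phi_add_L_right]
  obtain ⟨m, hm, hmQ⟩ : ∃ m : ℝ, 0 < m ∧ ∀ p ∈ Q, m ≤ ‖K.phi p.1 (p.1 + p.2)‖ := by
    rcases Q.eq_empty_or_nonempty with he | hne
    · exact ⟨1, one_pos, by simp [he]⟩
    · obtain ⟨p, hp, hmin⟩ := hQc.exists_isMinOn hne hcont.continuousOn
      refine ⟨_, norm_pos_iff.mpr (K.phi_ne_zero (s := p.1) (x := p.2) ?_ ?_), hmin⟩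
      · intro h0
        have : δ ≤ |p.2| := hp.2.2
        rw [h0, abs_zero] at this
        linarith
      · exact abs_le.mpr hp.2.1
  refine ⟨min (1 / 2) (m / (K.L / 2) ^ 2), by positivity, fun s x hx => ?_⟩
  rcases le_total |x| δ with hxδ | hxδ
  · refine le_trans ?_ (hnear s x hx hxδ)
    gcongr
    exact min_le_left _ _
  -- Shifting both points by a period brings the base point into the compact set `Q`.
  · obtain ⟨y, hy, e⟩ := (hper x).exists_mem_Ico₀ hL s
    rw [e]
    refine le_trans ?_ (hmQ (y, x) ⟨Ico_subset_Icc_self hy, abs_le.mp hx, hxδ⟩)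
    have hx2 : x ^ 2 ≤ (K.L / 2) ^ 2 := by rw [← sq_abs]; gcongr
    calc min (1 / 2) (m / (K.L / 2) ^ 2) * x ^ 2 ≤ m / (K.L / 2) ^ 2 * (K.L / 2) ^ 2 := by
          gcongr
          exact min_le_right _ _
      _ = m := by field_simp

theorem isBigO_inv_phi :
    (fun p : ℝ × ℝ => (K.phi p.1 (p.1 + p.2))⁻¹) =O[S] fun p => (p.2 ^ 2)⁻¹ := by
  obtain ⟨c, hc, h⟩ := K.exists_phi_lower_bound
  refine IsBigO.inv_rev (isBigO_principal.mpr ⟨c⁻¹, fun p hp => ?_⟩)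
    (eventually_principal.mpr fun p hp h0 => ?_)
  · have := h p.1 p.2 hp
    rw [norm_pow, Real.norm_eq_abs, sq_abs, inv_mul_eq_div, le_div_iff₀ hc]
    linarith
  · have : p.2 = 0 := by simpa using h0
    rw [this, add_zero, phi_self]

/-- The gain of two orders comes from the cubic term of `φ` being imaginary: it is orthogonal to the
leading term `x²`, so no `x⁵` appears. -/
theorem isBigO_normSq_phi_sub :
    (fun p : ℝ × ℝ => ‖K.phi p.1 (p.1 + p.2)‖ ^ 2 - p.2 ^ 4) =O[S] fun p => p.2 ^ 6 := by
  have r := K.isBigO_phi_sub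
  have x2 := isBigO_band_ofReal_pow (R := K.L / 2) 2
  have x3 := isBigO_band_ofReal_pow (R := K.L / 2) 3
  have r3 := r.trans (isBigO_band_pow_pow (m := 3) (by norm_num))
  have u : (fun p : ℝ × ℝ => K.phi p.1 (p.1 + p.2) - p.2 ^ 2) =O[S] fun p => p.2 ^ 3 := by
    have h := r3.add
      (((K.isBigO_curv.mul x3).congr_right (g₂ := fun p => p.2 ^ 3) (fun p => by ring)).const_mul_left
      (1 / 3))
    exact h.congr_left fun p => by ring
  have h := ((x2.mul (r.add r.conj)).congr_right (g₂ := fun p => p.2 ^ 6) (fun p => by ring)).add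
    ((u.mul u.conj).congr_right (g₂ := fun p => p.2 ^ 6) (fun p => by ring))
  refine IsBigO.of_norm_left (h.norm_left.congr_left fun p => ?_)
  have e : ((‖K.phi p.1 (p.1 + p.2)‖ ^ 2 - p.2 ^ 4 : ℝ) : ℂ) =
      K.phi p.1 (p.1 + p.2) * (starRingEnd ℂ) (K.phi p.1 (p.1 + p.2)) - (p.2 : ℂ) ^ 4 := by
    rw [Complex.mul_conj, Complex.normSq_eq_norm_sq]; push_cast; ring
  rw [← Complex.norm_real, e]
  congr 1
  simp [Complex.conj_ofNat]
  ring

theorem exists_chord_bound : ∃ C : ℝ, 0 ≤ C ∧ ∀ s x : ℝ, |x| ≤ K.L / 2 →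
    |K.chord s (s + x) ^ 2 - x ^ 2| ≤ C * x ^ 4 := by
  obtain ⟨C, hC⟩ := isBigO_principal.mp K.isBigO_normSq_phi_sub
  refine ⟨|C|, abs_nonneg C, fun s x hx => ?_⟩
  have h := hC (s, x) hx
  simp only [norm_phi, norm_pow, Real.norm_eq_abs] at h
  set d := K.chord s (s + x) ^ 2
  have hd : 0 ≤ d := sq_nonneg _
  rcases eq_or_ne x 0 with rfl | hx0
  · have : d = 0 := by simp [d, ← norm_phi, phi_self]
    simp [this]
  have hx2 : 0 < x ^ 2 := by positivity
  -- Here `d` is the squared chord; the second factor is at least `x²` and can be cancelled.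
  have e : d ^ 2 - x ^ 4 = (d - x ^ 2) * (d + x ^ 2) := by ring
  have e6 : |x| ^ 6 = x ^ 4 * x ^ 2 := by
    rw [show |x| ^ 6 = (|x| ^ 2) ^ 3 by ring, sq_abs]; ring
  rw [e, abs_mul, abs_of_nonneg (by positivity : 0 ≤ d + x ^ 2), e6] at h
  refine le_of_mul_le_mul_right ?_ hx2
  calc |d - x ^ 2| * x ^ 2 ≤ |d - x ^ 2| * (d + x ^ 2) := by gcongr; linarith
    _ ≤ C * (x ^ 4 * x ^ 2) := h
    _ ≤ |C| * (x ^ 4 * x ^ 2) := by gcongr; exact le_abs_self C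
    _ = _ := by ring

theorem chord_pos {s x : ℝ} (h0 : x ≠ 0) (hx : |x| ≤ K.L / 2) : 0 < K.chord s (s + x) := by
  refine lt_of_le_of_ne (K.chord_nonneg _ _) fun h => K.phi_ne_zero (s := s) h0 hx ?_
  rw [← norm_eq_zero, norm_phi, ← h]; norm_num

/-- The logarithm of the ratio of the chord to the arc is quadratically small. -/
theorem exists_log_chord_bound : ∃ M : ℝ, 0 ≤ M ∧ ∀ s x : ℝ, |x| ≤ K.L / 2 →
    |Real.log (K.chord s (s + x)) - Real.log x| ≤ M * x ^ 2 := by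
  obtain ⟨C, hC, h⟩ := K.exists_chord_bound
  obtain ⟨c, hc, h'⟩ := K.exists_phi_lower_bound
  -- With `y = d²/x²`, the upper bound `log y ≤ y - 1` costs `C`, and the lower bound `log y ≥ (y -
  -- 1)/y` costs `C/c` because `y ≥ c`. Negative `x` needs no separate case, since `Real.log x = log
  -- |x|`.
  refine ⟨C + C / c, by positivity, fun s x hx => ?_⟩
  rcases eq_or_ne x 0 with rfl | h0
  · have : K.chord s s = 0 := by
      have := K.norm_phi s s
      rw [phi_self, norm_zero] at this
      exact pow_eq_zero_iff (two_ne_zero)  |>.mp this.symm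
    simp [this]
  have hd := K.chord_pos (s := s) h0 hx
  have h1 := h s x hx
  have h2 := h' s x hx
  rw [norm_phi] at h2
  set d := K.chord s (s + x)
  have hx2 : 0 < x ^ 2 := by positivity
  set y := d ^ 2 / x ^ 2 with hy
  have hy0 : 0 < y := by positivity
  have e : Real.log d - Real.log x = 1 / 2 * Real.log y := by
    rw [hy, Real.log_div (by positivity) (by positivity), Real.log_pow, Real.log_pow]
    push_cast; ring
  have hy1 : |y - 1| ≤ C * x ^ 2 := by
    have : y - 1 = (d ^ 2 - x ^ 2) / x ^ 2 := by rw [hy]; field_simp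
    rw [this, abs_div, abs_of_pos hx2, div_le_iff₀ hx2]
    linarith
  have hyc : c ≤ y := by rw [hy, le_div_iff₀ hx2]; exact h2
  have hup := Real.log_le_sub_one_of_pos hy0
  have hlo := Real.one_sub_inv_le_log_of_pos hy0
  have hlo' : -(C / c * x ^ 2) ≤ 1 - y⁻¹ := by
    have : 1 - y⁻¹ = (y - 1) / y := by field_simp
    rw [this, le_div_iff₀ hy0]
    have h3 := (abs_le.mp hy1).1
    have h4 : C * x ^ 2 ≤ C / c * x ^ 2 * y := by
      have h6 : C * x ^ 2 = C / c * x ^ 2 * c := by field_simp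
      rw [h6]
      gcongr
    linarith
  have h5 := (abs_le.mp hy1).2
  have hC1 : 0 ≤ C * x ^ 2 := by positivity
  have hC2 : 0 ≤ C / c * x ^ 2 := by positivity
  rw [e, abs_le]
  constructor <;> nlinarith

/-- The second mixed derivative of `log chord`. -/
noncomputable def mixed (s t : ℝ) : ℂ :=
  deriv K.proj s * (starRingEnd ℂ) (deriv K.proj t) * (starRingEnd ℂ) (K.phi s t) / K.phi s t ^ 2

/-- Over the common denominator `φ² x²` the numerator is `O(x⁶)`: the `x⁴` terms cancel, and the
`x⁵` coefficients `iκ` (from the tangents), `-iκ/3` (from `conj φ`) and `-2iκ/3` (from `φ²`) sum to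
zero. At `x = 0` everything vanishes by the convention for division by zero. -/
theorem isBigO_mixed_sub :
    (fun p : ℝ × ℝ => K.mixed p.1 (p.1 + p.2) - 1 / (p.2 : ℂ) ^ 2) =O[S] fun _ => (1 : ℝ) := by
  have r := K.isBigO_phi_sub
  have r₁ := K.isBigO_deriv_proj_sub
  have c := K.isBigO_curv
  have φ := K.isBigO_phi
  have x2 := isBigO_band_ofReal_pow (R := K.L / 2) 2
  have x3 := (isBigO_band_ofReal_pow (R := K.L / 2) 3).trans
    (isBigO_band_pow_pow (m := 2) (by norm_num))
  have x6 := isBigO_band_ofReal_pow (R := K.L / 2) 6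
  have t1 := ((c.mul c).mul x6).congr_right (g₂ := fun p => p.2 ^ 6) (fun p => by ring)
  have t2 := (x2.mul r.conj).congr_right (g₂ := fun p => p.2 ^ 6) (fun p => by ring)
  have t3 := ((c.mul x3).mul r.conj).congr_right (g₂ := fun p => p.2 ^ 6) (fun p => by ring)
  have t4 := ((x2.mul K.isBigO_proj_d).mul (r₁.conj.mul φ.conj)).congr_right
    (g₂ := fun p => p.2 ^ 6) (fun p => by ring)
  have t5 := (r.mul φ).congr_right (g₂ := fun p => p.2 ^ 6) (fun p => by ring)
  have t6 := (r.mul (r.trans (isBigO_band_pow_pow (m := 2) (by norm_num)))).congr_right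
    (g₂ := fun p => p.2 ^ 6) (fun p => by ring)
  have num := ((((t1.const_mul_left (-(4 / 9))).add (t2.add t3)).add t4).add
    (t5.const_mul_left (-2))).add t6
  have xi : (fun p : ℝ × ℝ => ((p.2 : ℂ) ^ 2)⁻¹) =O[S] fun p => (p.2 ^ 2)⁻¹ :=
    isBigO_principal.mpr ⟨1, fun p _ => by simp⟩
  have h := num.mul ((K.isBigO_inv_phi.mul K.isBigO_inv_phi).mul xi)
  refine (h.trans (isBigO_principal.mpr ⟨1, fun p _ => ?_⟩)).congr' ?_ EventuallyEq.rfl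
  · rcases eq_or_ne p.2 0 with h0 | h0
    · simp [h0]
    · have : p.2 ^ 6 * ((p.2 ^ 2)⁻¹ * (p.2 ^ 2)⁻¹ * (p.2 ^ 2)⁻¹) = 1 := by field_simp
      rw [this]; simp
  · refine eventually_principal.mpr fun p hp => ?_
    rcases eq_or_ne p.2 0 with h0 | h0
    · simp [h0, mixed, phi_self]
    have hφ := K.phi_ne_zero (s := p.1) h0 hp
    have hx : (p.2 : ℂ) ≠ 0 := by exact_mod_cast h0
    have e1 := K.deriv_proj_mul_conj p.1
    have e2 := K.deriv_proj_mul_conj_deriv_deriv p.1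
    have e3 : K.mixed p.1 (p.1 + p.2) - 1 / (p.2 : ℂ) ^ 2 =
        (deriv K.proj p.1 * (starRingEnd ℂ) (deriv K.proj (p.1 + p.2)) *
          (starRingEnd ℂ) (K.phi p.1 (p.1 + p.2)) * p.2 ^ 2 - K.phi p.1 (p.1 + p.2) ^ 2) *
        ((K.phi p.1 (p.1 + p.2))⁻¹ * (K.phi p.1 (p.1 + p.2))⁻¹ * ((p.2 : ℂ) ^ 2)⁻¹) := by
      unfold mixed; field_simp
    beta_reduce
    rw [e3]
    congr 1
    simp only [map_sub, map_mul, map_div₀, map_pow, Complex.conj_ofReal, Complex.conj_I,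
      Complex.conj_ofNat]
    linear_combination -(p.2 : ℂ) ^ 2 * (starRingEnd ℂ) (K.phi p.1 (p.1 + p.2)) * (e1 + p.2 * e2)

/-- The derivative of `2 log chord` in the first variable is the real part of this function. -/
noncomputable def logDer (s t : ℝ) : ℂ :=
  -2 * (deriv K.proj s * (starRingEnd ℂ) (K.proj t - K.proj s)) / K.phi s t

/-- The quotient rule leaves `φ - 2 |z(t) - z(s)|²` in the numerator, which is `-conj φ`. -/
theorem hasDerivAt_logDer {s t : ℝ} (h : K.phi s t ≠ 0) :
    HasDerivAt (K.logDer s) (2 * K.mixed s t) t := by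
  have h1 := ((K.hasDerivAt_proj t).sub_const (K.proj s)).star
  have h2 := ((h1.const_mul (deriv K.proj s)).const_mul (-2)).fun_div (K.hasDerivAt_phi s t) h
  refine h2.congr_deriv ?_
  have e := Heis.pairing_add_conj (K.γ s) (K.γ t)
  change K.phi s t + (starRingEnd ℂ) (K.phi s t) = 2 * ((K.proj t - K.proj s) *
    (starRingEnd ℂ) (K.proj t - K.proj s)) at e
  rw [mixed]
  simp only [RCLike.star_def]
  field_simp
  linear_combination (-(deriv K.proj s * (starRingEnd ℂ) (deriv K.proj t))) * e

/-- The constant term in the expansion of `logDer` is `-iκ/3`, which the real part removes. So the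
regularized derivative tends to `0` on the diagonal. -/
theorem isBigO_logDer :
    (fun p : ℝ × ℝ => (K.logDer p.1 (p.1 + p.2)).re + 2 / p.2) =O[S] fun p => p.2 := by
  have r := K.isBigO_phi_sub
  have r₂ := K.isBigO_proj_sub
  have c := K.isBigO_curv
  have x1 := isBigO_band_ofReal_pow (R := K.L / 2) 1
  have x1' := (isBigO_band_ofReal_pow (R := K.L / 2) 1).trans
    (isBigO_band_pow_pow (m := 0) (by norm_num))
  have x4 := isBigO_band_ofReal_pow (R := K.L / 2) 4
  have t1 := ((x1.mul K.isBigO_proj_d).mul r₂.conj).congr_right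
    (g₂ := fun p => p.2 ^ 4) (fun p => by ring)
  have t3 := ((c.mul c).mul x4).congr_right (g₂ := fun p => p.2 ^ 4) (fun p => by ring)
  have t4 := ((c.mul x1').mul r).congr_right (g₂ := fun p => p.2 ^ 4) (fun p => by ring)
  have num := ((t1.const_mul_left (-2)).add (r.const_mul_left 2)).add
    ((t3.const_mul_left (1 / 9)).add (t4.const_mul_left (1 / 3)))
  have xi : (fun p : ℝ × ℝ => (p.2 : ℂ)⁻¹) =O[S] fun p => p.2⁻¹ :=
    isBigO_principal.mpr ⟨1, fun p _ => by simp⟩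
  have h := num.mul (K.isBigO_inv_phi.mul xi)
  obtain ⟨C, hC⟩ := isBigO_principal.mp h
  refine isBigO_principal.mpr ⟨C, fun p hp => ?_⟩
  rcases eq_or_ne p.2 0 with h0 | h0
  · simp [h0, logDer, phi_self]
  have hb := hC p hp
  have hφ := K.phi_ne_zero (s := p.1) h0 hp
  have hx : (p.2 : ℂ) ≠ 0 := by exact_mod_cast h0
  have e1 := K.deriv_proj_mul_conj p.1
  have e2 := K.deriv_proj_mul_conj_deriv_deriv p.1
  have e3 : p.2 ^ 4 * ((p.2 ^ 2)⁻¹ * p.2⁻¹) = p.2 := by field_simp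
  rw [e3] at hb
  refine le_trans ?_ hb
  have e4 : (K.logDer p.1 (p.1 + p.2)).re + 2 / p.2 =
      (K.logDer p.1 (p.1 + p.2) + 2 / p.2 + Complex.I * K.curv p.1 / 3).re := by
    rw [show (2 / (p.2 : ℂ)) = ((2 / p.2 : ℝ) : ℂ) by push_cast; rfl]
    simp
  rw [e4, Real.norm_eq_abs]
  refine (Complex.abs_re_le_norm _).trans (le_of_eq ?_)
  congr 1
  have e5 : K.logDer p.1 (p.1 + p.2) + 2 / p.2 + Complex.I * K.curv p.1 / 3 =
      (-2 * p.2 * (deriv K.proj p.1 * (starRingEnd ℂ) (K.proj (p.1 + p.2) - K.proj p.1)) +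
        2 * K.phi p.1 (p.1 + p.2) + Complex.I * K.curv p.1 / 3 * p.2 * K.phi p.1 (p.1 + p.2)) *
        ((K.phi p.1 (p.1 + p.2))⁻¹ * (p.2 : ℂ)⁻¹) := by
    unfold logDer; field_simp
  rw [e5]
  congr 1
  simp only [map_sub, map_mul, map_div₀, map_pow, Complex.conj_ofReal,
    Complex.conj_ofNat]
  linear_combination -2 * (p.2 : ℂ) ^ 2 * e1 - (p.2 : ℂ) ^ 3 * e2

end LegendrianKnot

/-! ### The cosine integrand and its integral over one variable -/

namespace LegendrianKnot

open Asymptotics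

variable (K : LegendrianKnot)

/-- The cosine formula divided by `chord²`. At coinciding points both sides are `0`, since division
by zero gives zero. -/
theorem cosIntegrand_eq (s t : ℝ) :
    K.cosIntegrand s t = 1 / K.chord s t ^ 2 - (K.mixed s t).re := by
  by_cases h : K.γ s = K.γ t
  · have h0 : K.phi s t = 0 := by rw [phi, h, Heis.pairing_self]
    have h1 : K.chord s t ^ 2 = 0 := by rw [← norm_phi, h0, norm_zero]
    simp [cosIntegrand, mixed, h0, h1]
  · have hc : K.chord s t ^ 2 ≠ 0 := by
      rw [← norm_phi]; exact norm_ne_zero_iff.mpr (Heis.pairing_ne_zero h)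
    have hex := Heis.exists_isRCircleAngle (K.horizontal s) (K.horizontal t) (K.unit_speed s)
      (K.unit_speed t) h
    have hang : Heis.IsRCircleAngle (K.γ s) (deriv K.γ s) (K.γ t) (deriv K.γ t) (K.angle s t) :=
      Classical.epsilon_spec hex
    have hcos := hang.cos_eq (K.horizontal t) (K.unit_speed s) (K.unit_speed t) h
    rw [← deriv_proj, ← deriv_proj] at hcos
    change _ = ‖K.phi s t‖ * (K.mixed s t).re at hcos
    rw [cosIntegrand, hcos, norm_phi, sub_div, mul_div_cancel_left₀ _ hc]

theorem measurable_phi : Measurable fun p : ℝ × ℝ => K.phi p.1 p.2 := K.continuous_phi.measurable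

theorem measurable_mixed : Measurable fun p : ℝ × ℝ => K.mixed p.1 p.2 := by
  have h1 := K.measurable_phi
  have h2 := K.contDiff_deriv_proj.continuous.measurable
  have h3 : Measurable (starRingEnd ℂ) := Complex.continuous_conj.measurable
  unfold mixed
  exact (((h2.comp measurable_fst).mul (h3.comp (h2.comp measurable_snd))).mul (h3.comp h1)).div
    (h1.pow_const 2)

theorem measurable_chord : Measurable fun p : ℝ × ℝ => K.chord p.1 p.2 := by
  have e : (fun p : ℝ × ℝ => K.chord p.1 p.2) = fun p => √‖K.phi p.1 p.2‖ := by
    funext p; rw [norm_phi, Real.sqrt_sq (K.chord_nonneg _ _)]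
  rw [e]
  exact K.measurable_phi.norm.sqrt

theorem measurable_cosIntegrand : Measurable fun p : ℝ × ℝ => K.cosIntegrand p.1 p.2 := by
  simp only [cosIntegrand_eq]
  exact ((measurable_const).div (K.measurable_chord.pow_const 2)).sub
    (Complex.measurable_re.comp K.measurable_mixed)

theorem exists_inv_chord_bound : ∃ M : ℝ, ∀ s x : ℝ, |x| ≤ K.L / 2 →
    |1 / K.chord s (s + x) ^ 2 - 1 / x ^ 2| ≤ M := by
  obtain ⟨C, hC, h⟩ := K.exists_chord_bound
  obtain ⟨c, hc, h'⟩ := K.exists_phi_lower_bound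
  refine ⟨C / c, fun s x hx => ?_⟩
  rcases eq_or_ne x 0 with rfl | h0
  · have : K.chord s s ^ 2 = 0 := by rw [← norm_phi, phi_self, norm_zero]
    simp [this]
    positivity
  have hd := K.chord_pos (s := s) h0 hx
  have h1 := h s x hx
  have h2 := h' s x hx
  rw [norm_phi] at h2
  have hx2 : 0 < x ^ 2 := by positivity
  rw [div_sub_div _ _ (by positivity) (by positivity), abs_div, one_mul, mul_one, abs_sub_comm,
    abs_of_pos (a := K.chord s (s + x) ^ 2 * x ^ 2) (by positivity), div_le_div_iff₀ (by positivity) hc]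
  calc |K.chord s (s + x) ^ 2 - x ^ 2| * c ≤ C * x ^ 4 * c := by gcongr
    _ = C * (c * x ^ 2 * x ^ 2) := by ring
    _ ≤ _ := by gcongr

theorem exists_mixed_bound : ∃ M : ℝ, ∀ s x : ℝ, |x| ≤ K.L / 2 →
    |1 / x ^ 2 - (K.mixed s (s + x)).re| ≤ M := by
  obtain ⟨M, hM⟩ := isBigO_principal.mp K.isBigO_mixed_sub
  refine ⟨M, fun s x hx => ?_⟩
  have h := hM (s, x) hx
  simp only [norm_one, mul_one] at h
  refine le_trans ?_ h
  have e : 1 / x ^ 2 - (K.mixed s (s + x)).re = -(K.mixed s (s + x) - 1 / (x : ℂ) ^ 2).re := by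
    rw [show 1 / (x : ℂ) ^ 2 = ((1 / x ^ 2 : ℝ) : ℂ) by push_cast; rfl, Complex.sub_re,
      Complex.ofReal_re, neg_sub]
  rw [e, abs_neg]
  exact Complex.abs_re_le_norm _

theorem chord_periodic (s : ℝ) : Function.Periodic (K.chord s) K.L := fun t => by
  simp [chord, K.periodic t]

theorem mixed_periodic (s : ℝ) : Function.Periodic (K.mixed s) K.L := fun t => by
  simp only [mixed, phi_add_L_right]
  rw [K.periodic_proj.deriv' t]

theorem cosIntegrand_periodic (s : ℝ) : Function.Periodic (K.cosIntegrand s) K.L := fun t => by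
  rw [cosIntegrand_eq, cosIntegrand_eq, K.chord_periodic, K.mixed_periodic]

theorem exists_cosIntegrand_bound : ∃ M : ℝ, ∀ s t : ℝ, ‖K.cosIntegrand s t‖ ≤ M := by
  obtain ⟨M₁, h₁⟩ := K.exists_inv_chord_bound
  obtain ⟨M₂, h₂⟩ := K.exists_mixed_bound
  refine ⟨M₁ + M₂, fun s t => ?_⟩
  obtain ⟨y, hy, e⟩ := (K.cosIntegrand_periodic s).exists_mem_Ico K.L_pos t (s - K.L / 2)
  have hy' : |y - s| ≤ K.L / 2 := by
    rw [abs_le]; constructor <;> linarith [hy.1, hy.2]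
  have a := h₁ s (y - s) hy'
  have b := h₂ s (y - s) hy'
  rw [add_sub_cancel] at a b
  rw [e, cosIntegrand_eq, Real.norm_eq_abs]
  calc _ = |(1 / K.chord s y ^ 2 - 1 / (y - s) ^ 2) +
        (1 / (y - s) ^ 2 - (K.mixed s y).re)| := by congr 1; ring
    _ ≤ _ := (abs_add_le _ _).trans (add_le_add a b)

theorem integrableOn_cosIntegrand_prod :
    IntegrableOn (fun x : ℝ × ℝ => K.cosIntegrand x.1 x.2) (Ioc 0 K.L ×ˢ Ioc 0 K.L) volume := by
  obtain ⟨M, hM⟩ := K.exists_cosIntegrand_bound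
  refine Measure.integrableOn_of_bounded (M := M) ?_
    K.measurable_cosIntegrand.aestronglyMeasurable (ae_of_all _ fun x => hM _ _)
  rw [Measure.volume_eq_prod, Measure.prod_prod]
  simp [ENNReal.mul_eq_top]

theorem integrableOn_cosIntegrand (s : ℝ) :
    IntegrableOn (fun t => K.cosIntegrand s t) (Ioc 0 K.L) volume := by
  obtain ⟨M, hM⟩ := K.exists_cosIntegrand_bound
  exact Measure.integrableOn_of_bounded (M := M) (by simp)
    (K.measurable_cosIntegrand.comp measurable_prodMk_left).aestronglyMeasurable
    (ae_of_all _ fun x => hM _ _)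

/-- Integration over a period, centred at `s`. -/
theorem setIntegral_period {E : Type*} [NormedAddCommGroup E] [NormedSpace ℝ E] {f : ℝ → E}
    (hf : Function.Periodic f K.L) (s : ℝ) :
    ∫ t in Ioc 0 K.L, f t = ∫ x in Icc (-(K.L / 2)) (K.L / 2), f (s + x) := by
  have hL := K.L_pos
  have h := hf.intervalIntegral_add_eq 0 (s + -(K.L / 2))
  rw [zero_add, show s + -(K.L / 2) + K.L = s + K.L / 2 by ring,
    ← intervalIntegral.integral_comp_add_left, intervalIntegral.integral_of_le hL.le,
    intervalIntegral.integral_of_le (by linarith)] at h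
  rw [h, integral_Icc_eq_integral_Ioc]

theorem measurable_comp_add {E : Type*} [MeasurableSpace E] {f : ℝ × ℝ → E} (hf : Measurable f)
    (s : ℝ) : Measurable fun x => f (s, s + x) :=
  hf.comp (measurable_const.prodMk (measurable_id.const_add s))

local notation "J" => Icc (-(K.L / 2)) (K.L / 2)

theorem integrableOn_inv_chord_sub (s : ℝ) :
    IntegrableOn (fun x => 1 / K.chord s (s + x) ^ 2 - 1 / x ^ 2) J volume := by
  obtain ⟨M, hM⟩ := K.exists_inv_chord_bound
  refine Measure.integrableOn_of_bounded (M := M) (by simp) ?_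
    (ae_restrict_of_forall_mem measurableSet_Icc fun x hx => hM s x (abs_le.mpr hx))
  exact (((measurable_const).div ((measurable_comp_add K.measurable_chord s).pow_const 2)).sub
    ((measurable_const).div (measurable_id.pow_const 2))).aestronglyMeasurable

theorem integrableOn_mixed_sub (s : ℝ) :
    IntegrableOn (fun x => 1 / x ^ 2 - (K.mixed s (s + x)).re) J volume := by
  obtain ⟨M, hM⟩ := K.exists_mixed_bound
  refine Measure.integrableOn_of_bounded (M := M) (by simp) ?_
    (ae_restrict_of_forall_mem measurableSet_Icc fun x hx => hM s x (abs_le.mpr hx))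
  exact (((measurable_const).div (measurable_id.pow_const 2)).sub
    (Complex.measurable_re.comp (measurable_comp_add K.measurable_mixed s))).aestronglyMeasurable

theorem logDer_periodic (s : ℝ) : Function.Periodic (K.logDer s) K.L := fun t => by
  simp only [logDer, phi_add_L_right, K.periodic_proj t]

/-- The integrand is the derivative of `G`. At the endpoints `±L/2` the two values of `logDer` agree
by periodicity, so only the term `-1/x` of `G` contributes. -/
theorem integral_mixed_sub (s : ℝ) :
    ∫ x in J, (1 / x ^ 2 - (K.mixed s (s + x)).re) = -(4 / K.L) := by
  have hL := K.L_pos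
  set G : ℝ → ℝ := fun x => -(1 / 2) * ((K.logDer s (s + x)).re + 2 / x) with hG
  have hd : ∀ x, x ≠ 0 → |x| ≤ K.L / 2 →
      HasDerivAt G (1 / x ^ 2 - (K.mixed s (s + x)).re) x := by
    intro x h0 hx
    have h1 := (K.hasDerivAt_logDer (K.phi_ne_zero (s := s) h0 hx)).comp_const_add s x
    have h2 := Complex.reCLM.hasFDerivAt.comp_hasDerivAt x h1
    have h3 := (h2.add ((hasDerivAt_inv h0).const_mul 2)).const_mul (-(1 / 2) : ℝ)
    refine h3.congr_deriv ?_
    simp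
    ring
  obtain ⟨C, hC⟩ := isBigO_principal.mp K.isBigO_logDer
  have hcont : ContinuousOn G J := by
    intro x hx
    rcases eq_or_ne x 0 with rfl | h0
    -- The value supplied by division by zero is also the limit of `G` at `0`, so `G` is continuous
    -- there and the fundamental theorem of calculus may omit this one point.
    · have hG0 : G 0 = 0 := by simp [hG, logDer, phi_self]
      rw [ContinuousWithinAt, hG0]
      refine squeeze_zero_norm' (a := fun x => 1 / 2 * (C * |x|)) ?_ ?_
      · filter_upwards [self_mem_nhdsWithin] with y hy
        have := hC (s, y) (abs_le.mpr hy)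
        simp only [Real.norm_eq_abs] at this
        rw [hG, Real.norm_eq_abs, abs_mul]
        norm_num
        linarith
      · have : Continuous fun x : ℝ => 1 / 2 * (C * |x|) := by fun_prop
        simpa using (this.tendsto 0).mono_left nhdsWithin_le_nhds
    · exact (hd x h0 (abs_le.mpr hx)).continuousAt.continuousWithinAt
  have h := integral_eq_of_hasDerivAt_off_countable_of_le G
    (fun x => 1 / x ^ 2 - (K.mixed s (s + x)).re) (a := -(K.L / 2)) (b := K.L / 2) (by linarith)
    (countable_singleton (0 : ℝ)) hcont
    (fun x hx => hd x hx.2 (abs_le.mpr (Ioo_subset_Icc_self hx.1)))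
    ((intervalIntegrable_iff_integrableOn_Icc_of_le (by linarith)).mpr (K.integrableOn_mixed_sub s))
  rw [integral_Icc_eq_integral_Ioc, ← intervalIntegral.integral_of_le (by linarith), h, hG]
  have hp : K.logDer s (s + K.L / 2) = K.logDer s (s + -(K.L / 2)) := by
    rw [← K.logDer_periodic s (s + -(K.L / 2))]; congr 1; ring
  simp only [hp]
  field_simp
  ring

/-- The integral of the cosine integrand in terms of the regularized inverse square chord. -/
theorem integral_cosIntegrand (s : ℝ) :
    ∫ t in Ioc 0 K.L, K.cosIntegrand s t =
      (∫ x in J, (1 / K.chord s (s + x) ^ 2 - 1 / x ^ 2)) - 4 / K.L := by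
  rw [K.setIntegral_period (K.cosIntegrand_periodic s) s, sub_eq_add_neg, ← K.integral_mixed_sub s,
    ← integral_add (K.integrableOn_inv_chord_sub s) (K.integrableOn_mixed_sub s)]
  refine integral_congr_ae (ae_of_all _ fun x => ?_)
  simp only [cosIntegrand_eq]
  ring

theorem integral_inv_sq_annulus {a η : ℝ} (h0 : 0 < η) (ha : η ≤ a) :
    IntegrableOn (fun x : ℝ => 1 / x ^ 2) {x | η ≤ |x| ∧ |x| ≤ a} ∧
    ∫ x in {x : ℝ | η ≤ |x| ∧ |x| ≤ a}, 1 / x ^ 2 = 2 / η - 2 / a := by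
  have hms : MeasurableSet {x : ℝ | η ≤ |x| ∧ |x| ≤ a} :=
    (measurableSet_le measurable_const measurable_norm).inter
      (measurableSet_le measurable_norm measurable_const)
  constructor
  · refine Measure.integrableOn_of_bounded (M := 1 / η ^ 2) ?_ ?_
      (ae_restrict_of_forall_mem hms fun x hx => ?_)
    · have hsub : {x : ℝ | η ≤ |x| ∧ |x| ≤ a} ⊆ Icc (-a) a := fun x hx => abs_le.mp hx.2
      exact ((measure_mono hsub).trans_lt measure_Icc_lt_top).ne
    · exact ((measurable_const).div (measurable_id.pow_const 2)).aestronglyMeasurable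
    · have : η ^ 2 ≤ x ^ 2 := by rw [← sq_abs x]; gcongr; exact hx.1
      rw [Real.norm_of_nonneg (by positivity)]
      gcongr
  · rw [← integral_indicator hms]
    have e : (indicator {x : ℝ | η ≤ |x| ∧ |x| ≤ a} fun x => 1 / x ^ 2) =
        fun x => (indicator (Icc η a) fun y => 1 / y ^ 2) |x| := by
      funext x
      simp only [indicator, mem_ofPred_eq, mem_Icc, sq_abs]
    rw [e, integral_comp_abs, setIntegral_indicator measurableSet_Icc,
      inter_eq_right.mpr (show Icc η a ⊆ Ioi 0 from fun x hx => lt_of_lt_of_le h0 hx.1),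
      integral_Icc_eq_integral_Ioc, ← intervalIntegral.integral_of_le ha]
    have hd : ∀ x ∈ uIcc η a, HasDerivAt (fun x : ℝ => -x⁻¹) (1 / x ^ 2) x := fun x hx => by
      rw [uIcc_of_le ha] at hx
      have hx0 : x ≠ 0 := (lt_of_lt_of_le h0 hx.1).ne'
      exact (hasDerivAt_inv hx0).neg.congr_deriv (by simp)
    rw [intervalIntegral.integral_eq_sub_of_hasDerivAt hd]
    · ring
    · refine ContinuousOn.intervalIntegrable fun x hx => ?_
      rw [uIcc_of_le ha] at hx
      have hx0 : x ≠ 0 := (lt_of_lt_of_le h0 hx.1).ne'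
      exact (continuousAt_const.div (continuousAt_id.pow 2) (pow_ne_zero 2 hx0)).continuousWithinAt

end LegendrianKnot

/-! ### The potential as a limit -/

namespace LegendrianKnot

variable (K : LegendrianKnot)

local notation "J" => Icc (-(K.L / 2)) (K.L / 2)

/-- The complement of a chord ball is squeezed between complements of intervals. -/
theorem exists_chord_ball_bound : ∃ k : ℝ, ∀ s ε x : ℝ, 0 < ε → |x| ≤ K.L / 2 →
    (ε ≤ K.chord s (s + x) → ε * Real.exp (-k * ε ^ 2) ≤ |x|) ∧
    (ε * Real.exp (k * ε ^ 2) ≤ |x| → ε ≤ K.chord s (s + x)) := by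
  obtain ⟨M, hM, h⟩ := K.exists_log_chord_bound
  -- A crude a priori ratio: `chord < ε` forces `|x| ≤ ε B`. Inserting this in the logarithmic
  -- estimate turns the error `M x²` into `M B² ε²`.
  set B := Real.exp (M * (K.L / 2) ^ 2) with hB
  have hB1 : 1 ≤ B := Real.one_le_exp (by positivity)
  have hk : M ≤ M * B ^ 2 := le_mul_of_one_le_right hM (one_le_pow₀ hB1)
  refine ⟨M * B ^ 2, fun s ε x hε hx => ?_⟩
  rcases eq_or_ne x 0 with rfl | h0
  · have hs : K.chord s s = 0 := by
      have := K.norm_phi s s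
      rw [phi_self, norm_zero] at this
      exact (pow_eq_zero_iff two_ne_zero).mp this.symm
    rw [add_zero, hs, abs_zero]
    refine ⟨fun h => absurd h (not_le.mpr hε), fun h => absurd h (not_le.mpr (by positivity))⟩
  have hd := K.chord_pos (s := s) h0 hx
  have hl := abs_le.mp (h s x hx)
  have hx0 : 0 < |x| := abs_pos.mpr h0
  rw [← Real.log_abs x, ← sq_abs x] at hl
  set d := K.chord s (s + x)
  set y := |x|
  constructor
  · intro hεd
    rcases le_total ε y with hy | hy
    · refine le_trans (mul_le_of_le_one_right hε.le (Real.exp_le_one_iff.mpr ?_)) hy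
      have : 0 ≤ M * B ^ 2 * ε ^ 2 := by positivity
      linarith
    · rw [← Real.log_le_log_iff (by positivity) hx0, Real.log_mul hε.ne' (Real.exp_ne_zero _),
        Real.log_exp]
      have h1 := Real.log_le_log hε hεd
      have h2 : M * y ^ 2 ≤ M * B ^ 2 * ε ^ 2 := by gcongr
      linarith [hl.2]
  · intro hεy
    by_contra! hlt
    have h1 := Real.log_lt_log hd hlt
    have h2 : M * y ^ 2 ≤ M * (K.L / 2) ^ 2 := by gcongr
    have h3 : y ≤ ε * B := by
      rw [← Real.log_le_log_iff hx0 (by positivity), Real.log_mul hε.ne' (Real.exp_ne_zero _),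
        Real.log_exp]
      linarith [hl.1]
    have h4 : M * y ^ 2 ≤ M * B ^ 2 * ε ^ 2 := by
      calc M * y ^ 2 ≤ M * (ε * B) ^ 2 := by gcongr
        _ = _ := by ring
    have h5 := Real.log_le_log (by positivity) hεy
    rw [Real.log_mul hε.ne' (Real.exp_ne_zero _), Real.log_exp] at h5
    linarith [hl.1]

theorem _root_.Real.tendsto_two_div_mul_exp_sub (c : ℝ) :
    Tendsto (fun ε : ℝ => 2 / (ε * Real.exp (c * ε ^ 2)) - 2 / ε) (𝓝[>] 0) (𝓝 0) := by
  -- The expression in question is the difference quotient at `0` of this function.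
  have h : HasDerivAt (fun ε : ℝ => 2 * Real.exp (-(c * ε ^ 2))) 0 0 := by
    have h1 := ((((hasDerivAt_id (0 : ℝ)).pow 2).const_mul c).neg.exp).const_mul 2
    refine h1.congr_deriv ?_
    simp
  have h2 := (hasDerivAt_iff_tendsto_slope_zero.mp h).mono_left
    (nhdsWithin_mono 0 (fun x (hx : x ∈ Ioi (0 : ℝ)) => ne_of_gt hx))
  refine h2.congr' ?_
  filter_upwards [self_mem_nhdsWithin] with ε hε
  have hε' : (0 : ℝ) < ε := hε
  simp [Real.exp_neg]
  field_simp

theorem measurable_comp_mk {E : Type*} [MeasurableSpace E] {f : ℝ × ℝ → E} (hf : Measurable f)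
    (s : ℝ) : Measurable fun t => f (s, t) :=
  hf.comp measurable_prodMk_left

theorem setIntegral_chord_ge (s ε : ℝ) :
    ∫ t in Ioc 0 K.L ∩ {t | ε ≤ K.chord s t}, 1 / K.chord s t ^ 2 =
      ∫ x in J, {x | ε ≤ K.chord s (s + x)}.indicator
        (fun x => 1 / K.chord s (s + x) ^ 2) x := by
  have hc : Measurable fun t => K.chord s t :=
    (measurable_comp_mk K.measurable_chord s :)
  have hm : MeasurableSet {t | ε ≤ K.chord s t} := measurableSet_le measurable_const hc
  have hp : Function.Periodic
      ({t | ε ≤ K.chord s t}.indicator fun t => 1 / K.chord s t ^ 2) K.L := fun t => by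
    simp only [indicator, mem_ofPred_eq, K.chord_periodic s t]
  exact (setIntegral_indicator hm).symm.trans (K.setIntegral_period hp s)

/-- Split `1/d²` into the integrable difference `1/d² - 1/x²`, where dominated convergence applies,
and `1/x²`, whose integral over `{d ≥ ε}` is squeezed between explicit integrals over annuli. -/
theorem isPotential (s : ℝ) : K.IsPotential s (∫ t in Ioc 0 K.L, K.cosIntegrand s t) := by
  have hL := K.L_pos
  obtain ⟨k, hk⟩ := K.exists_chord_ball_bound
  set A : ℝ → Set ℝ := fun ε => {x | ε ≤ K.chord s (s + x)} with hA
  have hAm : ∀ ε, MeasurableSet (A ε) := fun ε =>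
    measurableSet_le measurable_const (measurable_comp_add K.measurable_chord s)
  have hR : Tendsto (fun ε => ∫ x in J, (A ε).indicator
      (fun x => 1 / K.chord s (s + x) ^ 2 - 1 / x ^ 2) x) (𝓝[>] 0)
      (𝓝 (∫ x in J, (1 / K.chord s (s + x) ^ 2 - 1 / x ^ 2))) := by
    have hi := K.integrableOn_inv_chord_sub s
    refine tendsto_integral_filter_of_dominated_convergence
      (fun x => ‖1 / K.chord s (s + x) ^ 2 - 1 / x ^ 2‖)
      (Eventually.of_forall fun ε => hi.aestronglyMeasurable.indicator (hAm ε))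
      (Eventually.of_forall fun ε => ae_of_all _ fun x => norm_indicator_le_norm_self _ _)
      hi.norm ?_
    filter_upwards [ae_restrict_mem measurableSet_Icc,
      (measure_eq_zero_iff_ae_notMem.mp (measure_singleton (μ := volume.restrict J) (0 : ℝ)))]
      with x hx hx0
    have hd := K.chord_pos (s := s) (x := x) hx0 (abs_le.mpr hx)
    refine tendsto_const_nhds.congr' ?_
    filter_upwards [Ioo_mem_nhdsGT hd] with ε hε
    rw [indicator_of_mem (show x ∈ A ε from hε.2.le)]
  have hsmall : ∀ c : ℝ, ∀ᶠ ε in 𝓝[>] (0 : ℝ), ε * Real.exp (c * ε ^ 2) ≤ K.L / 2 := fun c => by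
    have : Continuous fun ε : ℝ => ε * Real.exp (c * ε ^ 2) := by fun_prop
    have h := (this.tendsto 0).mono_left (nhdsWithin_le_nhds (s := Ioi 0))
    simp only [zero_mul] at h
    exact h.eventually_le_const (by positivity)
  have hev : ∀ᶠ ε in 𝓝[>] (0 : ℝ),
      IntegrableOn ((A ε).indicator fun x => 1 / x ^ 2) J ∧
      2 / (ε * Real.exp (k * ε ^ 2)) - 2 / (K.L / 2) ≤
        ∫ x in J, (A ε).indicator (fun x => 1 / x ^ 2) x ∧
      ∫ x in J, (A ε).indicator (fun x => 1 / x ^ 2) x ≤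
        2 / (ε * Real.exp (-k * ε ^ 2)) - 2 / (K.L / 2) := by
    filter_upwards [hsmall k, hsmall (-k), self_mem_nhdsWithin] with ε h₁ h₂ hε
    have hε' : (0 : ℝ) < ε := hε
    obtain ⟨i₁, e₁⟩ := integral_inv_sq_annulus (by positivity) h₁
    obtain ⟨i₂, e₂⟩ := integral_inv_sq_annulus (by positivity) h₂
    have s₁ : {x : ℝ | ε * Real.exp (k * ε ^ 2) ≤ |x| ∧ |x| ≤ K.L / 2} ⊆ J ∩ A ε :=
      fun x hx => ⟨abs_le.mp hx.2, (hk s ε x hε' hx.2).2 hx.1⟩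
    have s₂ : J ∩ A ε ⊆ {x : ℝ | ε * Real.exp (-k * ε ^ 2) ≤ |x| ∧ |x| ≤ K.L / 2} :=
      fun x hx => ⟨(hk s ε x hε' (abs_le.mpr hx.1)).1 hx.2, abs_le.mpr hx.1⟩
    rw [setIntegral_indicator (hAm ε), ← e₁, ← e₂]
    have hn : ∀ x : ℝ, 0 ≤ 1 / x ^ 2 := fun x => by positivity
    refine ⟨?_, setIntegral_mono_set (i₂.mono_set s₂) (ae_of_all _ hn) (LE.le.eventuallyLE s₁),
      setIntegral_mono_set i₂ (ae_of_all _ hn) (LE.le.eventuallyLE s₂)⟩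
    rw [IntegrableOn, integrable_indicator_iff (hAm ε), IntegrableOn,
      Measure.restrict_restrict (hAm ε), inter_comm]
    exact i₂.mono_set s₂
  have hS : Tendsto (fun ε => (∫ x in J, (A ε).indicator (fun x => 1 / x ^ 2) x) - 2 / ε)
      (𝓝[>] 0) (𝓝 (-(4 / K.L))) := by
    have l := (Real.tendsto_two_div_mul_exp_sub k).sub_const (4 / K.L)
    have u := (Real.tendsto_two_div_mul_exp_sub (-k)).sub_const (4 / K.L)
    rw [zero_sub] at l u
    have e4 : 2 / (K.L / 2) = 4 / K.L := by field_simp; norm_num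
    refine tendsto_of_tendsto_of_tendsto_of_le_of_le' l u ?_ ?_
    · filter_upwards [hev] with ε h
      rw [e4] at h; linarith [h.2.1]
    · filter_upwards [hev] with ε h
      rw [e4] at h; linarith [h.2.2]
  rw [integral_cosIntegrand, sub_eq_add_neg, IsPotential]
  refine (hR.add hS).congr' ?_
  filter_upwards [hev] with ε h
  rw [setIntegral_chord_ge, ← add_sub_assoc, ← integral_add
    ((K.integrableOn_inv_chord_sub s).indicator (hAm ε)) h.1]
  congr 1
  refine integral_congr_ae (ae_of_all _ fun x => ?_)
  simp only [indicator]
  split_ifs <;> simp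

end LegendrianKnot

/-! ### Meromorphic continuation of the beta function and the energy -/

/-- The integral of a function of `|x|` over a symmetric interval. -/
theorem integral_Icc_comp_abs {E : Type*} [NormedAddCommGroup E] [NormedSpace ℝ E] {g : ℝ → E}
    {a : ℝ} (ha : 0 ≤ a) (hg : IntervalIntegrable g volume 0 a) :
    IntegrableOn (fun x => g |x|) (Icc (-a) a) volume ∧
      ∫ x in Icc (-a) a, g |x| = (2 : ℝ) • ∫ x in (0 : ℝ)..a, g x := by
  have e1 : ∀ x ∈ uIoc 0 a, g x = g |x| := fun x hx => by
    rw [uIoc_of_le ha] at hx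
    rw [abs_of_pos hx.1]
  have e2 : ∀ x ∈ uIoc (-a) 0, g (-x) = g |x| := fun x hx => by
    rw [uIoc_of_le (by linarith)] at hx
    rw [abs_of_nonpos hx.2]
  have h1 : IntervalIntegrable (fun x => g |x|) volume 0 a := hg.congr e1
  have h2' : IntervalIntegrable (fun x => g (-x)) volume (-a) 0 := by
    simpa using ((IntervalIntegrable.iff_comp_neg (by simp)).mp hg).symm
  have h2 : IntervalIntegrable (fun x => g |x|) volume (-a) 0 := h2'.congr e2
  have h3 := h2.trans h1
  constructor
  · exact (intervalIntegrable_iff_integrableOn_Icc_of_le (by linarith)).mp h3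
  · rw [integral_Icc_eq_integral_Ioc, ← intervalIntegral.integral_of_le (by linarith),
      ← intervalIntegral.integral_add_adjacent_intervals h2 h1,
      ← intervalIntegral.integral_congr_ae (ae_of_all _ e1),
      ← intervalIntegral.integral_congr_ae (ae_of_all _ e2),
      intervalIntegral.integral_comp_neg, neg_neg, neg_zero, two_smul]

theorem integrableOn_abs_rpow {a r : ℝ} (ha : 0 ≤ a) (hr : -1 < r) :
    IntegrableOn (fun x : ℝ => |x| ^ r) (Icc (-a) a) volume :=
  (integral_Icc_comp_abs (g := fun x => x ^ r) ha (intervalIntegral.intervalIntegrable_rpow' hr)).1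

theorem integral_abs_cpow {a : ℝ} {ζ : ℂ} (ha : 0 ≤ a) (hζ : -1 < ζ.re) :
    IntegrableOn (fun x : ℝ => ((|x| : ℝ) : ℂ) ^ ζ) (Icc (-a) a) volume ∧
    ∫ x in Icc (-a) a, ((|x| : ℝ) : ℂ) ^ ζ = 2 * ((a : ℂ) ^ (ζ + 1) / (ζ + 1)) := by
  have h := integral_Icc_comp_abs (g := fun x : ℝ => (x : ℂ) ^ ζ) ha
    (intervalIntegral.intervalIntegrable_cpow' hζ)
  refine ⟨h.1, h.2.trans ?_⟩
  have h0 : ζ + 1 ≠ 0 := by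
    intro h
    have := congrArg Complex.re h
    simp at this
    linarith
  rw [integral_cpow (Or.inl hζ), Complex.ofReal_zero, Complex.zero_cpow h0, sub_zero]
  simp

/-- Two meromorphic functions that agree near a point of a connected set agree near all its
points. -/
theorem MeromorphicOn.eventuallyEq_nhdsNE_of_eventuallyEq {f g : ℂ → ℂ} {U : Set ℂ}
    (hf : MeromorphicOn f U) (hg : MeromorphicOn g U) (hU : IsPreconnected U) {x y : ℂ}
    (hx : x ∈ U) (hy : y ∈ U) (h : f =ᶠ[𝓝[≠] x] g) : f =ᶠ[𝓝[≠] y] g := by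
  have hfg := hf.sub hg
  have hxt : meromorphicOrderAt (f - g) x = ⊤ := by
    rw [meromorphicOrderAt_eq_top_iff]
    filter_upwards [h] with z hz
    simp [hz]
  by_contra hne
  have hyt : meromorphicOrderAt (f - g) y ≠ ⊤ := by
    rw [Ne, meromorphicOrderAt_eq_top_iff]
    intro h'
    apply hne
    filter_upwards [h'] with z hz
    exact sub_eq_zero.mp hz
  exact hfg.meromorphicOrderAt_ne_top_of_isPreconnected hU hy hx hyt hxt

namespace LegendrianKnot

variable (K : LegendrianKnot)

local notation "J" => Icc (-(K.L / 2)) (K.L / 2)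

/-- The parameters `(s, x)` of the pairs of points `γ s`, `γ (s + x)`. -/
abbrev strip : Set (ℝ × ℝ) := Ioc 0 K.L ×ˢ Icc (-(K.L / 2)) (K.L / 2)

/-- The difference between the complex powers of the chord and of the arc. -/
noncomputable def powDiff (ζ : ℂ) (p : ℝ × ℝ) : ℂ :=
  ((K.chord p.1 (p.1 + p.2) : ℝ) : ℂ) ^ ζ - ((|p.2| : ℝ) : ℂ) ^ ζ

/-- The derivative of `powDiff` in the exponent. -/
noncomputable def powDiffDeriv (ζ : ℂ) (p : ℝ × ℝ) : ℂ :=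
  ((K.chord p.1 (p.1 + p.2) : ℝ) : ℂ) ^ ζ * Complex.log (K.chord p.1 (p.1 + p.2) : ℝ) -
    ((|p.2| : ℝ) : ℂ) ^ ζ * Complex.log (|p.2| : ℝ)

theorem measurable_comp_shear {E : Type*} [MeasurableSpace E] {f : ℝ × ℝ → E} (hf : Measurable f) :
    Measurable fun p : ℝ × ℝ => f (p.1, p.1 + p.2) :=
  hf.comp (measurable_fst.prodMk (measurable_fst.add measurable_snd))

theorem measurable_chord_add :
    Measurable fun p : ℝ × ℝ => ((K.chord p.1 (p.1 + p.2) : ℝ) : ℂ) := by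
  have h : Measurable fun p : ℝ × ℝ => K.chord p.1 (p.1 + p.2) :=
    (measurable_comp_shear K.measurable_chord :)
  exact h.complex_ofReal

theorem measurable_abs_snd : Measurable fun p : ℝ × ℝ => ((|p.2| : ℝ) : ℂ) :=
  measurable_snd.norm.complex_ofReal

theorem measurable_powDiff (ζ : ℂ) : Measurable (K.powDiff ζ) :=
  (K.measurable_chord_add.pow_const ζ).sub (measurable_abs_snd.pow_const ζ)

theorem measurable_powDiffDeriv (ζ : ℂ) : Measurable (K.powDiffDeriv ζ) :=
  ((K.measurable_chord_add.pow_const ζ).mul K.measurable_chord_add.clog).sub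
    ((measurable_abs_snd.pow_const ζ).mul measurable_abs_snd.clog)

theorem hasDerivAt_powDiff {p : ℝ × ℝ} (h0 : p.2 ≠ 0) (hp : |p.2| ≤ K.L / 2) (ζ : ℂ) :
    HasDerivAt (fun z => K.powDiff z p) (K.powDiffDeriv ζ p) ζ := by
  have h1 : ((K.chord p.1 (p.1 + p.2) : ℝ) : ℂ) ≠ 0 := by
    exact_mod_cast (K.chord_pos h0 hp).ne'
  have h2 : ((|p.2| : ℝ) : ℂ) ≠ 0 := by exact_mod_cast (abs_pos.mpr h0).ne'
  exact (((hasDerivAt_id ζ).const_cpow (Or.inl h1)).sub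
    ((hasDerivAt_id ζ).const_cpow (Or.inl h2))).congr_deriv (by simp [powDiffDeriv])

theorem exists_powDiff_bound (N : ℝ) : ∃ C : ℝ, 0 ≤ C ∧ ∀ (ζ : ℂ) (s x : ℝ), ‖ζ‖ ≤ N → x ≠ 0 →
    |x| ≤ K.L / 2 → ‖K.powDiff ζ (s, x)‖ ≤ C * |x| ^ (ζ.re + 2) := by
  obtain ⟨M, hM, h⟩ := K.exists_log_chord_bound
  refine ⟨|N| * M * Real.exp (|N| * (M * (K.L / 2) ^ 2)), by positivity,
    fun ζ s x hζ h0 hx => ?_⟩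
  have hd := K.chord_pos (s := s) h0 hx
  have hl := h s x hx
  have hx0 : 0 < |x| := abs_pos.mpr h0
  rw [← Real.log_abs x] at hl
  set d := K.chord s (s + x) with hdd
  set l := Real.log d - Real.log |x| with hl'
  have hζN : ‖ζ‖ ≤ |N| := hζ.trans (le_abs_self N)
  -- Since `d = |x| exp l` with `l = O(x²)`, factoring out `|x|^ζ` leaves `exp (lζ) - 1 = O(x²)` for
  -- bounded `ζ`.
  have e1 : ((d : ℝ) : ℂ) ^ ζ = ((|x| : ℝ) : ℂ) ^ ζ * Complex.exp (l * ζ) := by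
    rw [Complex.cpow_def_of_ne_zero (by exact_mod_cast hd.ne'),
      Complex.cpow_def_of_ne_zero (by exact_mod_cast hx0.ne'), ← Complex.ofReal_log hd.le,
      ← Complex.ofReal_log hx0.le, ← Complex.exp_add, hl']
    congr 1
    push_cast
    ring
  have e2 : K.powDiff ζ (s, x) = ((|x| : ℝ) : ℂ) ^ ζ * (Complex.exp (l * ζ) - 1) := by
    rw [powDiff]
    simp only [← hdd]
    rw [e1]; ring
  have hlζ : ‖(l : ℂ) * ζ‖ ≤ |N| * (M * x ^ 2) := by
    rw [norm_mul, Complex.norm_real, mul_comm]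
    gcongr
    exact hl
  have h1 : ‖Complex.exp (l * ζ) - 1‖ ≤ |N| * (M * x ^ 2) *
      Real.exp (|N| * (M * (K.L / 2) ^ 2)) := by
    have := Complex.norm_exp_sub_sum_le_norm_mul_exp ((l : ℂ) * ζ) 1
    simp only [Finset.sum_range_one, pow_zero, Nat.factorial_zero, Nat.cast_one, div_one,
      pow_one] at this
    refine this.trans ?_
    gcongr
    refine hlζ.trans ?_
    rw [← sq_abs x]
    gcongr
  rw [e2, norm_mul, Complex.norm_cpow_eq_rpow_re_of_pos hx0, Real.rpow_add hx0]
  calc |x| ^ ζ.re * ‖Complex.exp (l * ζ) - 1‖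
      ≤ |x| ^ ζ.re * (|N| * (M * x ^ 2) * Real.exp (|N| * (M * (K.L / 2) ^ 2))) := by gcongr
    _ = _ := by
      rw [Real.rpow_two, sq_abs]; ring

theorem ae_band : ∀ᵐ p ∂(volume.restrict K.strip), p.2 ≠ 0 ∧ |p.2| ≤ K.L / 2 := by
  have h1 : ∀ᵐ p ∂(volume.restrict K.strip), p ∈ K.strip :=
    ae_restrict_mem (measurableSet_Ioc.prod measurableSet_Icc)
  have h2 : ∀ᵐ p ∂(volume : Measure (ℝ × ℝ)), p.2 ≠ 0 :=
    Measure.quasiMeasurePreserving_snd.ae (p := fun x : ℝ => x ≠ 0)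
      (measure_eq_zero_iff_ae_notMem.mp (measure_singleton (0 : ℝ)))
  filter_upwards [h1, ae_restrict_of_ae h2] with p hp hp0
  exact ⟨hp0, abs_le.mpr hp.2⟩

theorem integrableOn_abs_snd_rpow {r : ℝ} (hr : -1 < r) :
    IntegrableOn (fun p : ℝ × ℝ => |p.2| ^ r) K.strip volume := by
  have hL := K.L_pos
  have h := integrableOn_abs_rpow (a := K.L / 2) (by linarith) hr
  rw [IntegrableOn, Measure.volume_eq_prod, ← Measure.prod_restrict]
  exact Integrable.comp_snd h _

theorem exists_powDiff_local_bound {ζ₀ : ℂ} (hζ₀ : -3 < ζ₀.re) :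
    ∃ r > 0, ∃ b : ℝ × ℝ → ℝ, IntegrableOn b K.strip volume ∧
      ∀ᵐ p ∂(volume.restrict K.strip), ∀ ζ ∈ Metric.closedBall ζ₀ r, ‖K.powDiff ζ p‖ ≤ b p := by
  -- Half the distance to the line `Re ζ = -3`, so that the smallest exponent `Re ζ₀ - r + 2` still
  -- exceeds `-1`. The sum of two powers in the bound covers both `|x| ≤ 1` and `|x| ≥ 1`.
  set r := (ζ₀.re + 3) / 2 with hr
  have hr0 : 0 < r := by rw [hr]; linarith
  obtain ⟨C, hC, h⟩ := K.exists_powDiff_bound (‖ζ₀‖ + r)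
  refine ⟨r, hr0, fun p => C * (|p.2| ^ (ζ₀.re - r + 2) + |p.2| ^ (ζ₀.re + r + 2)),
    ((K.integrableOn_abs_snd_rpow (by rw [hr]; linarith)).add
      (K.integrableOn_abs_snd_rpow (by linarith))).const_mul C, ?_⟩
  filter_upwards [K.ae_band] with p hp ζ hζ
  have hζ' : ‖ζ - ζ₀‖ ≤ r := by simpa [dist_eq_norm] using hζ
  have hn : ‖ζ‖ ≤ ‖ζ₀‖ + r := by
    have := norm_add_le ζ₀ (ζ - ζ₀)
    rw [add_sub_cancel] at this
    linarith
  have hre := abs_le.mp ((Complex.abs_re_le_norm (ζ - ζ₀)).trans hζ')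
  rw [Complex.sub_re] at hre
  refine (h ζ p.1 p.2 hn hp.1 hp.2).trans ?_
  have hx0 : 0 < |p.2| := abs_pos.mpr hp.1
  gcongr
  rcases le_total |p.2| 1 with h1 | h1
  · have := Real.rpow_le_rpow_of_exponent_ge hx0 h1
      (show ζ₀.re - r + 2 ≤ ζ.re + 2 by linarith [hre.1])
    have : 0 ≤ |p.2| ^ (ζ₀.re + r + 2) := by positivity
    linarith
  · have := Real.rpow_le_rpow_of_exponent_le h1
      (show ζ.re + 2 ≤ ζ₀.re + r + 2 by linarith [hre.2])
    have : 0 ≤ |p.2| ^ (ζ₀.re - r + 2) := by positivity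
    linarith

theorem integrableOn_powDiff {ζ : ℂ} (hζ : -3 < ζ.re) : IntegrableOn (K.powDiff ζ) K.strip volume := by
  obtain ⟨r, hr, b, hb, h⟩ := K.exists_powDiff_local_bound hζ
  refine Integrable.mono' hb (K.measurable_powDiff ζ).aestronglyMeasurable ?_
  filter_upwards [h] with p hp
  exact hp ζ (Metric.mem_closedBall_self hr.le)

theorem differentiableAt_integral_powDiff {ζ₀ : ℂ} (hζ₀ : -3 < ζ₀.re) :
    DifferentiableAt ℂ (fun ζ => ∫ p in K.strip, K.powDiff ζ p) ζ₀ := by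
  obtain ⟨r, hr, b, hb, h⟩ := K.exists_powDiff_local_bound hζ₀
  have hr2 : 0 < r / 2 := by positivity
  refine (hasDerivAt_integral_of_dominated_loc_of_deriv_le (F' := K.powDiffDeriv)
    (bound := fun p => b p / (r / 2)) (Metric.ball_mem_nhds ζ₀ hr2)
    (Eventually.of_forall fun ζ => (K.measurable_powDiff ζ).aestronglyMeasurable)
    (K.integrableOn_powDiff hζ₀) (K.measurable_powDiffDeriv ζ₀).aestronglyMeasurable ?_
    (hb.div_const _) ?_).2.differentiableAt
  · filter_upwards [h, K.ae_band] with p hp hp' ζ hζ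
    rw [← (K.hasDerivAt_powDiff hp'.1 hp'.2 ζ).deriv]
    -- Cauchy's estimate on circles of radius `r/2`, which stay inside the ball where `b` dominates,
    -- bounds the derivative without estimating logarithms.
    refine Complex.norm_deriv_le_of_forall_mem_sphere_norm_le hr2 ?_ fun z hz => hp z ?_
    · exact Differentiable.diffContOnCl fun z =>
        (K.hasDerivAt_powDiff hp'.1 hp'.2 z).differentiableAt
    · rw [Metric.mem_closedBall]
      rw [Metric.mem_ball] at hζ
      rw [Metric.mem_sphere] at hz
      linarith [dist_triangle z ζ ζ₀]
  · filter_upwards [K.ae_band] with p hp' ζ _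
    exact K.hasDerivAt_powDiff hp'.1 hp'.2 ζ

/-- The explicit meromorphic continuation of the beta function. -/
noncomputable def betaContinuation (ζ : ℂ) : ℂ :=
  2 * K.L * (((K.L / 2 : ℝ) : ℂ) ^ (ζ + 1) / (ζ + 1)) + ∫ p in K.strip, K.powDiff ζ p

theorem isOpen_halfPlane : IsOpen {ζ : ℂ | -3 < ζ.re} :=
  isOpen_lt continuous_const Complex.continuous_re

theorem analyticAt_integral_powDiff {ζ : ℂ} (hζ : -3 < ζ.re) :
    AnalyticAt ℂ (fun ζ => ∫ p in K.strip, K.powDiff ζ p) ζ :=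
  DifferentiableOn.analyticAt (s := {ζ : ℂ | -3 < ζ.re})
    (fun _ hz => (K.differentiableAt_integral_powDiff hz).differentiableWithinAt)
    (isOpen_halfPlane.mem_nhds hζ)

theorem analyticAt_half_cpow (ζ : ℂ) :
    AnalyticAt ℂ (fun ζ => 2 * (K.L : ℂ) * ((K.L / 2 : ℝ) : ℂ) ^ (ζ + 1)) ζ := by
  have h0 : ((K.L / 2 : ℝ) : ℂ) ≠ 0 := by
    have := K.L_pos
    exact_mod_cast (by positivity : K.L / 2 ≠ 0)
  have hd : Differentiable ℂ fun ζ : ℂ => 2 * (K.L : ℂ) * ((K.L / 2 : ℝ) : ℂ) ^ (ζ + 1) :=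
    fun z => (((hasDerivAt_id z).add_const 1).const_cpow (Or.inl h0)).differentiableAt.const_mul _
  exact hd.analyticAt ζ

theorem analyticAt_betaContinuation {ζ : ℂ} (hζ : -3 < ζ.re) (h1 : ζ ≠ -1) :
    AnalyticAt ℂ K.betaContinuation ζ := by
  have h : AnalyticAt ℂ (fun ζ : ℂ => ζ + 1) ζ := analyticAt_id.add analyticAt_const
  have := ((K.analyticAt_half_cpow ζ).div h
    (fun h => h1 (eq_neg_of_add_eq_zero_left h))).add (K.analyticAt_integral_powDiff hζ)
  refine this.congr (Eventually.of_forall fun z => ?_)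
  simp [betaContinuation, mul_div_assoc]

theorem meromorphicOn_betaContinuation : MeromorphicOn K.betaContinuation {ζ : ℂ | -3 < ζ.re} := by
  intro ζ hζ
  have h : AnalyticAt ℂ (fun ζ : ℂ => ζ + 1) ζ := analyticAt_id.add analyticAt_const
  have := ((K.analyticAt_half_cpow ζ).meromorphicAt.div h.meromorphicAt).add
    (K.analyticAt_integral_powDiff hζ).meromorphicAt
  refine this.congr (Eventually.of_forall fun z => ?_)
  simp [betaContinuation, mul_div_assoc]

theorem setIntegral_prod_powDiff {ζ : ℂ} (hζ : -3 < ζ.re) :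
    ∫ p in K.strip, K.powDiff ζ p = ∫ s in Ioc 0 K.L, ∫ x in J, K.powDiff ζ (s, x) := by
  have h := K.integrableOn_powDiff hζ
  rw [Measure.volume_eq_prod] at h ⊢
  exact setIntegral_prod _ h

/-- In this range `|x|^ζ` is itself integrable, so the subtracted term can be added back. -/
theorem betaContinuation_eq {ζ : ℂ} (hζ : -1 < ζ.re) :
    K.betaContinuation ζ =
      ∫ s in (0 : ℝ)..K.L, ∫ t in (0 : ℝ)..K.L, ((K.chord s t : ℝ) : ℂ) ^ ζ := by
  have hL := K.L_pos
  have hζ3 : -3 < ζ.re := by linarith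
  have hi := K.integrableOn_powDiff hζ3
  rw [IntegrableOn, Measure.volume_eq_prod, ← Measure.prod_restrict] at hi
  obtain ⟨ia, ea⟩ := integral_abs_cpow (a := K.L / 2) (by linarith) hζ
  have hin : ∀ᵐ s ∂(volume.restrict (Ioc 0 K.L)),
      ∫ t in (0 : ℝ)..K.L, ((K.chord s t : ℝ) : ℂ) ^ ζ =
        (∫ x in J, K.powDiff ζ (s, x)) + 2 * (((K.L / 2 : ℝ) : ℂ) ^ (ζ + 1) / (ζ + 1)) := by
    filter_upwards [hi.prod_right_ae] with s hs
    have hp : Function.Periodic (fun t => ((K.chord s t : ℝ) : ℂ) ^ ζ) K.L := fun t => by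
      simp only [K.chord_periodic s t]
    rw [intervalIntegral.integral_of_le hL.le, K.setIntegral_period hp s, ← ea,
      ← integral_add hs ia]
    refine integral_congr_ae (ae_of_all _ fun x => ?_)
    simp [powDiff]
  rw [intervalIntegral.integral_of_le hL.le, integral_congr_ae hin,
    integral_add hi.integral_prod_left (integrable_const _), betaContinuation,
    K.setIntegral_prod_powDiff hζ3, add_comm]
  congr 1
  simp [hL.le]
  ring

theorem exists_isBetaFunction : ∃ F, K.IsBetaFunction F := by
  refine ⟨toMeromorphicNFOn K.betaContinuation {ζ : ℂ | -3 < ζ.re},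
    meromorphicNFOn_toMeromorphicNFOn _ _, fun ζ hζ => ?_⟩
  have hζ3 : -3 < ζ.re := by linarith
  have h1 : ζ ≠ -1 := by rintro rfl; simp at hζ
  rw [toMeromorphicNFOn_eq_toMeromorphicNFAt K.meromorphicOn_betaContinuation hζ3,
    toMeromorphicNFAt_eq_self.mpr (K.analyticAt_betaContinuation hζ3 h1).meromorphicNFAt,
    K.betaContinuation_eq hζ]

theorem isBetaFunction_betaFunction : K.IsBetaFunction K.betaFunction :=
  Classical.epsilon_spec K.exists_isBetaFunction

theorem betaFunction_eventuallyEq : K.betaFunction =ᶠ[𝓝 (-2)] K.betaContinuation := by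
  obtain ⟨hm, he⟩ := K.isBetaFunction_betaFunction
  have h2 : (-2 : ℂ) ∈ {ζ : ℂ | -3 < ζ.re} := by simp; norm_num
  have h0 : (0 : ℂ) ∈ {ζ : ℂ | -3 < ζ.re} := by simp
  have hconv : IsPreconnected {ζ : ℂ | -3 < ζ.re} := (convex_halfSpace_re_gt (-3)).isPreconnected
  have hev : K.betaFunction =ᶠ[𝓝 0] K.betaContinuation := by
    filter_upwards [(isOpen_lt continuous_const Complex.continuous_re).mem_nhds
      (show (0 : ℂ) ∈ {ζ : ℂ | -1 < ζ.re} by simp)] with ζ hζ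
    rw [he ζ hζ, K.betaContinuation_eq hζ]
  have h := hm.meromorphicOn.eventuallyEq_nhdsNE_of_eventuallyEq K.meromorphicOn_betaContinuation
    hconv h0 h2 (hev.filter_mono nhdsWithin_le_nhds)
  -- The identity theorem gives equality only on a punctured neighbourhood; normal form at `-2`
  -- extends it to the point itself, where the energy is evaluated.
  exact ((hm h2).eventuallyEq_nhdsNE_iff_eventuallyEq_nhds
    (K.analyticAt_betaContinuation h2 (by norm_num)).meromorphicNFAt).mp h

theorem analyticAt_betaFunction : AnalyticAt ℂ K.betaFunction (-2) :=
  (K.analyticAt_betaContinuation (by simp; norm_num) (by norm_num)).congr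
    K.betaFunction_eventuallyEq.symm

theorem powDiff_neg_two (s x : ℝ) :
    K.powDiff (-2) (s, x) = ((1 / K.chord s (s + x) ^ 2 - 1 / x ^ 2 : ℝ) : ℂ) := by
  have h : ∀ y : ℝ, (y : ℂ) ^ (-2 : ℂ) = ((1 / y ^ 2 : ℝ) : ℂ) := fun y => by
    rw [Complex.cpow_neg, Complex.cpow_ofNat]; push_cast; simp
  rw [powDiff, h, h, sq_abs]
  push_cast
  rfl

/-- At `ζ = -2` the explicit term of the continuation is `-4`, which is the integral over `s` of the
constant `-4/L` from `integral_cosIntegrand`; the remaining integrals coincide. -/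
theorem energy_eq : K.energy =
    ((∫ x in Ioc 0 K.L ×ˢ Ioc 0 K.L, K.cosIntegrand x.1 x.2 : ℝ) : ℂ) := by
  have hL := K.L_pos
  have h2 : -3 < (-2 : ℂ).re := by simp; norm_num
  have hi := K.integrableOn_powDiff h2
  rw [IntegrableOn, Measure.volume_eq_prod, ← Measure.prod_restrict] at hi
  have hir : Integrable (fun s => ∫ x in J, (1 / K.chord s (s + x) ^ 2 - 1 / x ^ 2))
      (volume.restrict (Ioc 0 K.L)) := by
    have := hi.integral_prod_left.re
    simp only [powDiff_neg_two, integral_complex_ofReal] at this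
    simpa using this
  rw [energy, K.betaFunction_eventuallyEq.self_of_nhds, betaContinuation,
    K.setIntegral_prod_powDiff h2]
  have hc := K.integrableOn_cosIntegrand_prod
  rw [Measure.volume_eq_prod] at hc ⊢
  rw [setIntegral_prod _ hc]
  simp only [powDiff_neg_two, integral_complex_ofReal, integral_cosIntegrand]
  rw [integral_sub hir (integrable_const _)]
  have e1 : ((K.L / 2 : ℝ) : ℂ) ^ (-2 + 1 : ℂ) = ((2 / K.L : ℝ) : ℂ) := by
    rw [show (-2 + 1 : ℂ) = -1 by norm_num, Complex.cpow_neg_one]; push_cast; simp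
  have hLc : (K.L : ℂ) ≠ 0 := by exact_mod_cast hL.ne'
  rw [e1]
  simp [hL.le]
  field_simp
  ring

end LegendrianKnot

theorem mainTheorem3 (K : LegendrianKnot) :
    (K.IsBetaFunction K.betaFunction ∧ AnalyticAt ℂ K.betaFunction (-2)) ∧
    (IntegrableOn (fun x : ℝ × ℝ => K.cosIntegrand x.1 x.2)
        (Set.Ioc 0 K.L ×ˢ Set.Ioc 0 K.L) volume ∧
      K.energy = ((∫ x in Set.Ioc 0 K.L ×ˢ Set.Ioc 0 K.L, K.cosIntegrand x.1 x.2 : ℝ) : ℂ)) ∧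
    (∀ s : ℝ, IntegrableOn (fun t => K.cosIntegrand s t) (Set.Ioc 0 K.L) volume ∧
      K.IsPotential s (∫ t in Set.Ioc 0 K.L, K.cosIntegrand s t)) :=
  ⟨⟨K.isBetaFunction_betaFunction, K.analyticAt_betaFunction⟩,
    ⟨K.integrableOn_cosIntegrand_prod, K.energy_eq⟩,
    fun s => ⟨K.integrableOn_cosIntegrand s, K.isPotential s⟩⟩
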